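/- Let $n\ge 1$ and $d\ge 2$. Let $\mathcal X$ be a measurable space and $k:\mathcal X\times\mathcal X\to\mathbb R^{d\times d}$ a (jointly measurable) matrix-valued positive definite kernel, i.e. $k(x,x')=k(x',x)^\top$ and $\sum_{i,j}a_i^\top k(x_i,x_j)a_j\ge 0$ for all finite families $x_i\in\mathcal X$, $a_i\in\mathbb R^d$. Let $\mathcal H$ be the corresponding vector-valued reproducing kernel Hilbert space of functions $\mathcal X\to\mathbb R^d$. Let $\mathcal Y\subset\mathbb R^d$, and let $c:\mathcal Y\to[d]=\{1,\dots,d\}$ be the (measurable) map that sends a target to the class it encodes (e.g. $c(e_j)=j$ for one-hot targets $e_j$). For $f:\mathcal X\to\mathbb R^d$ and $(x,y)\in\mathcal X\times\mathcal Y$ let $$\rho_f(x,y)=f(x)_{c(y)}-\max_{j\ne c(y)}f(x)_{j}$$ be the prediction margin. Let $(X_1,Y_1),\dots,(X_n,Y_n)$ be drawn i.i.d. from a probability distribution $P$ on $\mathcal X\times\mathcal Y$, let $\boldsymbol Y=(Y_1^\top,\dots,Y_n^\top)^\top\in\mathbb R^{nd}$, and let $K\in\mathbb R^{nd\times nd}$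 be the kernel matrix whose $(i,j)$ block is $k(X_i,X_j)$. Assume that $\kappa=\sup_{x\in\mathcal X,\,j\in[d]}k(x,x)_{j,j}<\infty$ and that $K$ has full rank almost surely. Let $\ell:\mathbb R^d\times\mathcal Y\to\mathbb R$ be a loss with $\ell(u,y)\ge 0$ for all $u\in\mathbb R^d$, $y\in\mathcal Y$ and $\ell(y,y)=0$ for all $y\in\mathcal Y$. Let $\lambda>0$, $\gamma>0$, $\delta>0$ and $M_0=\left\lceil \gamma\sqrt n/(4d\sqrt\kappa)\right\rceil$. Then, with probability at least $1-\delta$ over the sample, every solution $$f^*\in\operatorname*{arg\,min}_{f\in\mathcal H}\ \frac1n\sum_{i=1}^n\ell(f(X_i),Y_i)+\frac{\lambda}{2}\|f\|_{\mathcal H}^2$$ satisfies $$P\big(\{(x,y):\rho_{f^*}(x,y)\le 0\}\big)\le\frac1n\sum_{i=1}^n\mathbf 1\{\rho_{f^*}(X_i,Y_i)\le\gamma\}+\frac{4d\,(\boldsymbol Y^\top K^{-1}\boldsymbol Y+1)}{\gamma n}\sqrt{\operatorname{tr}(K)}+3\sqrt{\frac{\log(2M_0/\delta)}{2n}}.$$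 -/

import Mathlib

open MeasureTheory ProbabilityTheory

noncomputable section

namespace VectorKernel

/-- A matrix-valued positive (semi)definite kernel: `k x x' = (k x' x)ᵀ`, and
`∑ i j, aᵢᵀ k(xᵢ, xⱼ) aⱼ ≥ 0` for all finite families of points and vectors. -/
def IsPositiveKernel {𝓧 : Type*} {d : ℕ} (k : 𝓧 → 𝓧 → Matrix (Fin d) (Fin d) ℝ) : Prop :=
  (∀ x x', k x x' = (k x' x).transpose) ∧
    ∀ (m : ℕ) (x : Fin m → 𝓧) (a : Fin m → Fin d → ℝ),
      0 ≤ ∑ i, ∑ j, dotProduct (a i) ((k (x i) (x j)).mulVec (a j))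

/-- `H` is the vector-valued RKHS of `k`: it is a Hilbert space of functions `𝓧 → ℝᵈ` with
continuous point evaluations whose reproducing kernel is `k`. -/
def HasKernel {𝓧 : Type*} {d : ℕ} (H : Type*) [NormedAddCommGroup H] [InnerProductSpace ℝ H]
    [CompleteSpace H] [RKHS ℝ H 𝓧 (EuclideanSpace ℝ (Fin d))]
    (k : 𝓧 → 𝓧 → Matrix (Fin d) (Fin d) ℝ) : Prop :=
  ∀ x x', RKHS.kernel H x x' = Matrix.toEuclideanCLM (n := Fin d) (𝕜 := ℝ) (k x x')

/-- The `nd × nd` kernel matrix of the points `x₁, …, xₙ`; its `(i, j)` block is `k(xᵢ, xⱼ)`. -/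
def kernelMatrix {𝓧 : Type*} {n d : ℕ} (k : 𝓧 → 𝓧 → Matrix (Fin d) (Fin d) ℝ)
    (x : Fin n → 𝓧) : Matrix (Fin n × Fin d) (Fin n × Fin d) ℝ :=
  Matrix.of fun p q => k (x p.1) (x q.1) p.2 q.2

/-- The concatenation of the targets `y₁, …, yₙ ∈ ℝᵈ` into one vector of length `nd`. -/
def concatTargets {n d : ℕ} (y : Fin n → EuclideanSpace ℝ (Fin d)) : Fin n × Fin d → ℝ :=
  fun p => y p.1 p.2

/-- The supervision complexity `Yᵀ K⁻¹ Y` (used where the kernel matrix is invertible). -/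
def supervisionComplexity {𝓧 : Type*} {n d : ℕ} (k : 𝓧 → 𝓧 → Matrix (Fin d) (Fin d) ℝ)
    (x : Fin n → 𝓧) (y : Fin n → EuclideanSpace ℝ (Fin d)) : ℝ :=
  dotProduct (concatTargets y) ((kernelMatrix k x)⁻¹.mulVec (concatTargets y))

/-- The regularized empirical risk `(1/n) ∑ ℓ(f(xᵢ), yᵢ) + (lam/2) ‖f‖²`. -/
def regularizedRisk {𝓧 : Type*} {n d : ℕ} {𝓨 : Set (EuclideanSpace ℝ (Fin d))}
    {H : Type*} [NormedAddCommGroup H] [InnerProductSpace ℝ H]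
    [RKHS ℝ H 𝓧 (EuclideanSpace ℝ (Fin d))]
    (ℓ : EuclideanSpace ℝ (Fin d) → 𝓨 → ℝ) (lam : ℝ)
    (x : Fin n → 𝓧) (y : Fin n → 𝓨) (f : H) : ℝ :=
  (1 / (n : ℝ)) * ∑ i, ℓ (f (x i)) (y i) + lam / 2 * ‖f‖ ^ 2

/-- The prediction margin `u_c - max_{c' ≠ c} u_{c'}` of a score vector `u` at the class `c`
(a maximum over a nonempty set as soon as there are at least two classes). -/
def margin {d : ℕ} (u : EuclideanSpace ℝ (Fin d)) (c : Fin d) : ℝ :=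
  u c - ⨆ c' : {c' : Fin d // c' ≠ c}, u c'

end VectorKernel

end

/-! Instead of norm balls and a union bound over `M₀` radii, a quadratic penalty treats all of `H`
at once. For clamped margins `g f`, the quantity to control is `sup_f (∑ g f (z i) - n E[g f] - b
(‖f‖² + 1))`. Because `⟪h, f⟫ - b ‖f‖² ≤ ‖h‖² / (4b)`, the Rademacher average of the penalized class
is finite (`sum_signs_le_of_lipschitz`). If `g` is Lipschitz through functionals `e z j` and `b² ≥ d
n E ∑ⱼ ‖e z j‖²`, symmetrization makes the mean nonpositive, and McDiarmid's inequality gives a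
deviation bound uniform in `f` (`exists_measurableSet_deviation_le`). So `M₀` matters only through
`M₀ ≥ 1`.

The penalty `b` must be deterministic, whereas the claim contains the empirical `√(tr K)`. Write
`q(x) = tr k(x, x)`, `y = √(log(2/δ) / (2n))` and `r = 6y²`, and choose `t` with `E min(t q, 1) =
r`. Points with `t q > 1` have probability at most `r` and are given up; on the others `E ∑ⱼ ‖e z
j‖² ≤ 4r / (γ² t)`. A Chernoff bound gives `tr K > n r / (4t)`, so the deterministic scale `√(n r /
t)` is at most `2 √(tr K)`. Each of the two events fails with probability at most `δ/2`. The extra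
cost `y + r` is at most `3y` when `y ≤ 1/3`; otherwise the claimed bound exceeds one.

Finally, comparing a minimizer with the minimal norm interpolant of the targets, which has zero
loss, gives `‖f‖² ≤ Yᵀ K⁻¹ Y`. -/

/-! ### Concentration under bounded differences -/

theorem integrable_exp_mul_of_abs_le {Ω : Type*} [MeasurableSpace Ω] (μ : Measure Ω)
    [IsFiniteMeasure μ] {f : Ω → ℝ} (hf : Measurable f) {B : ℝ} (hB : ∀ x, |f x| ≤ B) (t : ℝ) :
    Integrable (fun x => Real.exp (t * f x)) μ := by
  refine Integrable.of_bound (hf.const_mul t).exp.aestronglyMeasurable (Real.exp (|t| * B))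
    (.of_forall fun p => ?_)
  rw [Real.norm_eq_abs, Real.abs_exp]
  refine Real.exp_le_exp.2 ((le_abs_self _).trans ?_)
  rw [abs_mul]
  exact mul_le_mul_of_nonneg_left (hB _) (abs_nonneg _)

/-- **McDiarmid's inequality**, moment generating function form. -/
theorem integral_exp_le_of_bounded_differences {Z : Type*} [MeasurableSpace Z] (P : Measure Z)
    [IsProbabilityMeasure P] {c : ℝ} (t : ℝ) (n : ℕ) (F : (Fin n → Z) → ℝ) (hF : Measurable F)
    (B : ℝ) (hB : ∀ x, |F x| ≤ B)
    (hd : ∀ x i z, |F (Function.update x i z) - F x| ≤ c) :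
    ∫ x, Real.exp (t * F x) ∂(Measure.pi fun _ : Fin n => P) ≤
      Real.exp (t * ∫ x, F x ∂(Measure.pi fun _ : Fin n => P) + n * (c ^ 2 * t ^ 2 / 8)) := by
  induction n with
  | zero =>
    have h : ∀ x, F x = F default := fun x => by rw [Subsingleton.elim x default]
    simp [h]
  | succ n ih =>
    obtain ⟨z₀⟩ : Nonempty Z := nonempty_of_isProbabilityMeasure P
    set Q := Measure.pi fun _ : Fin n => P
    have hcons : Measurable fun p : Z × (Fin n → Z) => (Fin.cons p.1 p.2 : Fin (n + 1) → Z) := by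
      refine measurable_pi_lambda _ fun i => ?_
      refine Fin.cases ?_ (fun j => ?_) i
      · simpa using measurable_fst
      · exact (measurable_pi_apply j).comp measurable_snd
    have hpush : ∀ G : (Fin (n + 1) → Z) → ℝ,
        ∫ x, G x ∂(Measure.pi fun _ : Fin (n + 1) => P) = ∫ p, G (Fin.cons p.1 p.2) ∂(P.prod Q) := by
      intro G
      rw [← ((measurePreserving_piFinSuccAbove (fun _ : Fin (n + 1) => P) 0).symm).integral_comp']
      simp [MeasurableEquiv.piFinSuccAbove_symm_apply, Fin.insertNthEquiv, Q]
    have hFm : Measurable fun p : Z × (Fin n → Z) => F (Fin.cons p.1 p.2) := hF.comp hcons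
    have hFi : Integrable (fun p : Z × (Fin n → Z) => F (Fin.cons p.1 p.2)) (P.prod Q) :=
      Integrable.of_bound hFm.aestronglyMeasurable B (.of_forall fun p => hB _)
    have hEi : Integrable (fun p : Z × (Fin n → Z) => Real.exp (t * F (Fin.cons p.1 p.2)))
        (P.prod Q) := integrable_exp_mul_of_abs_le _ hFm (fun _ => hB _) t
    rw [hpush, hpush, integral_prod_symm _ hFi, integral_prod_symm _ hEi]
    -- Averaging out the first coordinate preserves measurability, the bound `B` and the differences
    -- `c`, so the induction hypothesis applies to `G`.
    set G : (Fin n → Z) → ℝ := fun y => ∫ z, F (Fin.cons z y) ∂P with hG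
    have hFy : ∀ y : Fin n → Z, Measurable fun z => F (Fin.cons z y) := fun y =>
      hFm.comp (measurable_id.prodMk measurable_const)
    have hFyi : ∀ y : Fin n → Z, Integrable (fun z => F (Fin.cons z y)) P := fun y =>
      Integrable.of_bound (hFy y).aestronglyMeasurable B (.of_forall fun p => hB _)
    have hGm : Measurable G :=
      (StronglyMeasurable.integral_prod_left' (μ := P) hFm.stronglyMeasurable).measurable
    have hGB : ∀ y, |G y| ≤ B := fun y => by
      simpa using norm_integral_le_of_norm_le_const (μ := P) (f := fun z => F (Fin.cons z y))
        (.of_forall fun z => hB (Fin.cons z y))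
    have hGd : ∀ x i z, |G (Function.update x i z) - G x| ≤ c := by
      intro x i z
      rw [hG]
      simp only
      rw [← integral_sub (hFyi _) (hFyi _)]
      have hw : ∀ w, ‖F (Fin.cons w (Function.update x i z)) - F (Fin.cons w x)‖ ≤ c := fun w => by
        have := hd (Fin.cons w x) i.succ z
        rwa [← Fin.cons_update] at this
      simpa using norm_integral_le_of_norm_le_const (μ := P) (.of_forall hw)
    have hinner : ∀ y, ∫ z, Real.exp (t * F (Fin.cons z y)) ∂P ≤
        Real.exp (t * G y) * Real.exp (c ^ 2 * t ^ 2 / 8) := by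
      intro y
      -- With `y` fixed, any two values differ by at most `c`, so all lie in an interval of length
      -- `c` and Hoeffding's lemma applies.
      set I := ⨅ z, F (Fin.cons z y)
      have hbdd : BddBelow (Set.range fun z => F (Fin.cons z y)) :=
        ⟨-B, by rintro _ ⟨z, rfl⟩; exact (abs_le.1 (hB _)).1⟩
      have hmem : ∀ᵐ z ∂P, F (Fin.cons z y) ∈ Set.Icc I (I + c) := by
        refine .of_forall fun z => ⟨ciInf_le hbdd z, ?_⟩
        rw [← sub_le_iff_le_add]
        have : Nonempty Z := ⟨z₀⟩
        refine le_ciInf fun w => ?_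
        have := hd (Fin.cons w y) 0 z
        simp only [Fin.update_cons_zero] at this
        linarith [(abs_le.1 this).2]
      have h1 := (hasSubgaussianMGF_of_mem_Icc (hFy y).aemeasurable hmem).mgf_le t
      have h2 : ∫ z, Real.exp (t * F (Fin.cons z y)) ∂P =
          Real.exp (t * G y) * mgf (fun z => F (Fin.cons z y) - ∫ w, F (Fin.cons w y) ∂P) P t := by
        rw [mgf, ← integral_const_mul]
        congr 1 with z
        rw [← Real.exp_add, hG]
        ring_nf
      rw [h2]
      refine mul_le_mul_of_nonneg_left (h1.trans (Real.exp_le_exp.2 (le_of_eq ?_))) (Real.exp_nonneg _)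
      simp [div_pow]
      ring
    calc ∫ y, ∫ z, Real.exp (t * F (Fin.cons z y)) ∂P ∂Q
        ≤ ∫ y, Real.exp (t * G y) * Real.exp (c ^ 2 * t ^ 2 / 8) ∂Q := by
          refine integral_mono hEi.integral_prod_right ?_ hinner
          exact (integrable_exp_mul_of_abs_le _ hGm hGB t).mul_const _
      _ = (∫ y, Real.exp (t * G y) ∂Q) * Real.exp (c ^ 2 * t ^ 2 / 8) := integral_mul_const _ _
      _ ≤ _ := by
          refine (mul_le_mul_of_nonneg_right (ih G hGm hGB hGd) (Real.exp_nonneg _)).trans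
            (le_of_eq ?_)
          rw [← Real.exp_add]
          push_cast
          ring_nf

/-- **McDiarmid's inequality** for differences bounded by one and a nonpositive mean. -/
theorem measureReal_ge_le_of_bounded_differences {Z : Type*} [MeasurableSpace Z] (P : Measure Z)
    [IsProbabilityMeasure P] (n : ℕ) (F : (Fin n → Z) → ℝ) (hF : Measurable F)
    (B : ℝ) (hB : ∀ x, |F x| ≤ B)
    (hd : ∀ x i z, |F (Function.update x i z) - F x| ≤ 1)
    (hE : ∫ x, F x ∂(Measure.pi fun _ : Fin n => P) ≤ 0) {y : ℝ} (hy : 0 ≤ y) :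
    (Measure.pi fun _ : Fin n => P).real {x | n * y ≤ F x} ≤ Real.exp (-(2 * n * y ^ 2)) := by
  -- `t = 4y` minimizes the exponent `-t n y + n t² / 8`.
  have h := measure_ge_le_exp_mul_mgf (μ := Measure.pi fun _ : Fin n => P) (X := F) (t := 4 * y)
    (n * y) (by positivity) (integrable_exp_mul_of_abs_le _ hF hB _)
  refine h.trans ?_
  have h2 := integral_exp_le_of_bounded_differences P (4 * y) n F hF B hB hd
  rw [mgf]
  refine (mul_le_mul_of_nonneg_left h2 (Real.exp_nonneg _)).trans ?_
  rw [← Real.exp_add]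
  refine Real.exp_le_exp.2 ?_
  nlinarith [mul_nonneg hy (neg_nonneg.2 hE)]

/-! ### Contraction with a quadratic penalty -/

open scoped RealInnerProductSpace in
/-- Contraction for Rademacher averages with a quadratic penalty: the `ψ i` are Lipschitz for the
`ℓ¹`-seminorm of the functionals `⟪e i j, ·⟫`, and `F` is an arbitrary choice of a point for
every sign pattern. -/
theorem sum_signs_le_of_lipschitz {E : Type*} [NormedAddCommGroup E] [InnerProductSpace ℝ E]
    {d : ℕ} (hd : 0 < d) {b : ℝ} (hb : 0 < b) (n : ℕ) (ψ : Fin n → E → ℝ) (e : Fin n → Fin d → E)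
    (hψ : ∀ i f g, |ψ i f - ψ i g| ≤ ∑ j, |⟪e i j, f - g⟫|) (h : E) (F : (Fin n → Bool) → E) :
    ∑ σ : Fin n → Bool, (⟪h, F σ⟫ - b * ‖F σ‖ ^ 2 + ∑ i, (if σ i then 1 else -1) * ψ i (F σ)) ≤
      2 ^ n * ((‖h‖ ^ 2 + d * ∑ i, ∑ j, ‖e i j‖ ^ 2) / (4 * b)) := by
  induction n generalizing h with
  | zero =>
    simp only [Finset.univ_unique, Finset.sum_singleton, Finset.univ_eq_empty, Finset.sum_empty,
      pow_zero, one_mul, mul_zero, add_zero]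
    generalize F _ = f
    rw [le_div_iff₀ (by positivity)]
    nlinarith [sq_nonneg (‖h‖ - 2 * b * ‖f‖),
      mul_le_mul_of_nonneg_left (real_inner_le_norm h f) hb.le]
  | succ n ih =>
    have hdR : (0 : ℝ) < d := Nat.cast_pos.2 hd
    set D := ∑ i : Fin n, ∑ j, ‖e i.succ j‖ ^ 2
    set A : E → (Fin n → Bool) → E → ℝ := fun h σ f =>
      ⟪h, f⟫ - b * ‖f‖ ^ 2 + ∑ i, (if σ i then 1 else -1) * ψ i.succ f with hA
    have hAadd : ∀ u σ f, A (h + u) σ f = A h σ f + ⟪u, f⟫ := fun u σ f => by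
      simp only [hA, inner_add_left]; ring
    -- For a fixed `j`, naming the two points according to the sign of the inner product removes the
    -- absolute value. It then becomes a shift of `h` by `± d • e 0 j`, which the induction
    -- hypothesis absorbs since it holds for every `h` and every choice of points.
    have key : ∀ j, ∑ σ, (A h σ (F (Fin.cons true σ)) + A h σ (F (Fin.cons false σ)) +
        d * |⟪e 0 j, F (Fin.cons true σ) - F (Fin.cons false σ)⟫|) ≤
        2 ^ (n + 1) * ((‖h‖ ^ 2 + d ^ 2 * ‖e 0 j‖ ^ 2 + d * D) / (4 * b)) := by
      intro j
      set p : (Fin n → Bool) → Prop := fun σ =>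
        0 ≤ ⟪e 0 j, F (Fin.cons true σ) - F (Fin.cons false σ)⟫
      classical
      set G₁ : (Fin n → Bool) → E := fun σ =>
        if p σ then F (Fin.cons true σ) else F (Fin.cons false σ) with hG₁
      set G₂ : (Fin n → Bool) → E := fun σ =>
        if p σ then F (Fin.cons false σ) else F (Fin.cons true σ) with hG₂
      have i1 := ih (fun i => ψ i.succ) (fun i => e i.succ) (fun i => hψ i.succ)
        (h + (d : ℝ) • e 0 j) G₁
      have i2 := ih (fun i => ψ i.succ) (fun i => e i.succ) (fun i => hψ i.succ)
        (h + -((d : ℝ) • e 0 j)) G₂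
      have e1 : ∑ σ, (A h σ (F (Fin.cons true σ)) + A h σ (F (Fin.cons false σ)) +
          d * |⟪e 0 j, F (Fin.cons true σ) - F (Fin.cons false σ)⟫|) =
          ∑ σ, A (h + (d : ℝ) • e 0 j) σ (G₁ σ) + ∑ σ, A (h + -((d : ℝ) • e 0 j)) σ (G₂ σ) := by
        rw [← Finset.sum_add_distrib]
        refine Finset.sum_congr rfl fun σ _ => ?_
        rw [hAadd, hAadd, inner_neg_left, real_inner_smul_left, real_inner_smul_left]
        by_cases hp : p σ
        · simp only [hG₁, hG₂, hp, if_true, abs_of_nonneg (show 0 ≤ _ from hp)]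
          rw [inner_sub_right]; ring
        · simp only [hG₁, hG₂, hp, if_false]
          rw [abs_of_neg (not_le.1 hp), inner_sub_right]; ring
      rw [e1]
      refine (add_le_add i1 i2).trans (le_of_eq ?_)
      -- Parallelogram law: the cross terms of the two shifts cancel.
      have n1 := norm_add_sq_real h ((d : ℝ) • e 0 j)
      have n2 := norm_sub_sq_real h ((d : ℝ) • e 0 j)
      rw [← sub_eq_add_neg, n1, n2, norm_smul, Real.norm_of_nonneg hdR.le]
      simp only [D]
      ring
    have hsplit : ∑ σ : Fin (n + 1) → Bool,
        (⟪h, F σ⟫ - b * ‖F σ‖ ^ 2 + ∑ i, (if σ i then 1 else -1) * ψ i (F σ)) =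
        ∑ σ : Fin n → Bool, (A h σ (F (Fin.cons true σ)) + ψ 0 (F (Fin.cons true σ)) +
          (A h σ (F (Fin.cons false σ)) - ψ 0 (F (Fin.cons false σ)))) := by
      rw [← (Fin.consEquiv fun _ : Fin (n + 1) => Bool).sum_comp, Fintype.sum_prod_type]
      rw [Fintype.sum_bool, ← Finset.sum_add_distrib]
      refine Finset.sum_congr rfl fun σ _ => ?_
      have hc : ∀ u, (Fin.consEquiv fun _ : Fin (n + 1) => Bool) (u, σ) = Fin.cons u σ :=
        fun _ => rfl
      simp only [hA, hc, Fin.sum_univ_succ, Fin.cons_zero, Fin.cons_succ, if_true,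
        Bool.false_eq_true, if_false]
      ring
    rw [hsplit]
    -- The sum of `d` absolute values is the average over `j` of `d` times each, so one `j` at a
    -- time suffices. The square `d²` divided by `d` leaves the factor `d`.
    have hav : ∀ x : ℝ, x = (1 / d : ℝ) * ∑ _j : Fin d, x := fun x => by
      simp; field_simp
    calc _ ≤ ∑ σ : Fin n → Bool, (1 / d : ℝ) * ∑ j, (A h σ (F (Fin.cons true σ)) +
            A h σ (F (Fin.cons false σ)) +
            d * |⟪e 0 j, F (Fin.cons true σ) - F (Fin.cons false σ)⟫|) := by
          refine Finset.sum_le_sum fun σ _ => ?_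
          rw [Finset.sum_add_distrib, mul_add, ← hav, ← Finset.mul_sum, ← mul_assoc,
            one_div_mul_cancel hdR.ne', one_mul]
          linarith [(le_abs_self _).trans (hψ 0 (F (Fin.cons true σ)) (F (Fin.cons false σ)))]
      _ = (1 / d : ℝ) * ∑ j, ∑ σ : Fin n → Bool, (A h σ (F (Fin.cons true σ)) +
            A h σ (F (Fin.cons false σ)) +
            d * |⟪e 0 j, F (Fin.cons true σ) - F (Fin.cons false σ)⟫|) := by
          rw [← Finset.mul_sum, Finset.sum_comm]
      _ ≤ (1 / d : ℝ) * ∑ j, 2 ^ (n + 1) *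
            ((‖h‖ ^ 2 + d ^ 2 * ‖e 0 j‖ ^ 2 + d * D) / (4 * b)) := by
          gcongr with j
          exact key j
      _ = _ := by
          rw [← Finset.mul_sum, ← Finset.sum_div, Finset.sum_add_distrib, Finset.sum_add_distrib,
            ← Finset.mul_sum, Fin.sum_univ_succ]
          simp only [Finset.sum_const, Finset.card_univ, Fintype.card_fin, nsmul_eq_mul]
          simp only [D]
          field_simp
          ring

/-! ### Symmetrization and the penalized supremum -/

theorem measurePreserving_ite_pi {Z : Type*} [MeasurableSpace Z] (P : Measure Z)
    [IsProbabilityMeasure P] {n : ℕ} (σ : Fin n → Bool) :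
    MeasurePreserving (fun p : (Fin n → Z) × (Fin n → Z) => fun i => if σ i then p.1 i else p.2 i)
      ((Measure.pi fun _ => P).prod (Measure.pi fun _ => P)) (Measure.pi fun _ => P) := by
  have hm : Measurable
      (fun p : (Fin n → Z) × (Fin n → Z) => fun i => if σ i then p.1 i else p.2 i) := by
    refine measurable_pi_lambda _ fun i => ?_
    by_cases h : σ i
    · simpa [h] using measurable_fst.eval
    · simpa [h] using measurable_snd.eval
  refine ⟨hm, (Measure.pi_eq fun s hs => ?_).symm⟩
  rw [Measure.map_apply hm (.univ_pi hs)]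
  have : (fun p : (Fin n → Z) × (Fin n → Z) => fun i => if σ i then p.1 i else p.2 i) ⁻¹'
      Set.univ.pi s = (Set.univ.pi fun i => if σ i then s i else Set.univ) ×ˢ
        (Set.univ.pi fun i => if σ i then Set.univ else s i) := by
    ext p
    simp only [Set.mem_preimage, Set.mem_univ_pi, Set.mem_prod]
    rw [← forall_and]
    refine forall_congr' fun i => ?_
    by_cases h : σ i <;> simp [h]
  rw [this, Measure.prod_prod, Measure.pi_pi, Measure.pi_pi, ← Finset.prod_mul_distrib]
  refine Finset.prod_congr rfl fun i _ => ?_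
  by_cases h : σ i <;> simp [h]

/-- The supremum over `f` of `∑ i, c i * g f (w i)` penalized by `b * (‖f‖ ^ 2 + 1)`. -/
noncomputable def penalizedSup {E Z ι : Type*} [NormedAddCommGroup E] [Fintype ι]
    (g : E → Z → ℝ) (b : ℝ) (c : ι → ℝ) (w : ι → Z) : ℝ :=
  ⨆ f : E, (∑ i, c i * g f (w i) - b * (‖f‖ ^ 2 + 1))

theorem abs_sum_mul_le_of_mem_Icc {E Z ι : Type*} [Fintype ι] {g : E → Z → ℝ}
    (hg : ∀ f z, g f z ∈ Set.Icc (0 : ℝ) 1) (c : ι → ℝ) (w : ι → Z) (f : E) :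
    |∑ i, c i * g f (w i)| ≤ ∑ i, |c i| := by
  refine (Finset.abs_sum_le_sum_abs _ _).trans (Finset.sum_le_sum fun i _ => ?_)
  rw [abs_mul, abs_of_nonneg (hg f (w i)).1]
  exact mul_le_of_le_one_right (abs_nonneg _) (hg f (w i)).2

section PenalizedSup

variable {E Z ι : Type*} [NormedAddCommGroup E] [Fintype ι] {g : E → Z → ℝ} {b : ℝ}

theorem bddAbove_penalizedSup (hg : ∀ f z, g f z ∈ Set.Icc (0 : ℝ) 1) (hb : 0 ≤ b) (c : ι → ℝ)
    (w : ι → Z) :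
    BddAbove (Set.range fun f : E => ∑ i, c i * g f (w i) - b * (‖f‖ ^ 2 + 1)) := by
  refine ⟨∑ i, |c i|, ?_⟩
  rintro _ ⟨f, rfl⟩
  have := (abs_le.1 (abs_sum_mul_le_of_mem_Icc hg c w f)).2
  have : 0 ≤ b * (‖f‖ ^ 2 + 1) := by positivity
  simp only
  linarith

theorem le_penalizedSup (hg : ∀ f z, g f z ∈ Set.Icc (0 : ℝ) 1) (hb : 0 ≤ b) (c : ι → ℝ)
    (w : ι → Z) (f : E) :
    ∑ i, c i * g f (w i) - b * (‖f‖ ^ 2 + 1) ≤ penalizedSup g b c w :=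
  le_ciSup (bddAbove_penalizedSup hg hb c w) f

theorem abs_penalizedSup_le (hg : ∀ f z, g f z ∈ Set.Icc (0 : ℝ) 1) (hb : 0 ≤ b) (c : ι → ℝ)
    (w : ι → Z) : |penalizedSup g b c w| ≤ ∑ i, |c i| + b := by
  rw [abs_le]
  constructor
  · have h1 := le_penalizedSup hg hb c w 0
    have h2 := (abs_le.1 (abs_sum_mul_le_of_mem_Icc hg c w 0)).1
    simp only [norm_zero] at h1
    linarith
  · refine ciSup_le fun f => ?_
    have := (abs_le.1 (abs_sum_mul_le_of_mem_Icc hg c w f)).2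
    have : 0 ≤ b * (‖f‖ ^ 2 + 1) := by positivity
    linarith

theorem penalizedSup_update_sub_le [DecidableEq ι] (hg : ∀ f z, g f z ∈ Set.Icc (0 : ℝ) 1)
    (hb : 0 ≤ b) (c : ι → ℝ) (w : ι → Z) (i : ι) (z : Z) :
    |penalizedSup g b c (Function.update w i z) - penalizedSup g b c w| ≤ |c i| := by
  have key : ∀ w w' : ι → Z, (∀ j, j ≠ i → w j = w' j) →
      penalizedSup g b c w ≤ penalizedSup g b c w' + |c i| := by
    intro w w' h
    refine ciSup_le fun f => ?_
    have h1 := le_penalizedSup hg hb c w' f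
    have h2 : ∑ j, c j * g f (w j) - ∑ j, c j * g f (w' j) ≤ |c i| := by
      rw [← Finset.sum_sub_distrib, Finset.sum_eq_single i]
      · rw [← mul_sub]
        refine (le_abs_self _).trans ?_
        rw [abs_mul]
        refine mul_le_of_le_one_right (abs_nonneg _) (abs_le.2 ?_)
        constructor <;> linarith [(hg f (w i)).1, (hg f (w i)).2, (hg f (w' i)).1, (hg f (w' i)).2]
      · intro j _ hj
        rw [h j hj, sub_self]
      · simp
    linarith
  rw [abs_le]
  constructor
  · linarith [key w (Function.update w i z) fun j hj => by rw [Function.update_of_ne hj]]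
  · linarith [key (Function.update w i z) w fun j hj => by rw [Function.update_of_ne hj]]

theorem sum_signs_flip {n : ℕ} (φ : Fin n → Bool → ℝ) :
    2 * ∑ σ : Fin n → Bool, ∑ i, φ i (σ i) = 2 ^ n * ∑ i, (φ i true + φ i false) := by
  have hinv : Function.Involutive fun (σ : Fin n → Bool) i => !σ i := fun σ => by simp
  have h1 : ∑ σ : Fin n → Bool, ∑ i, φ i (σ i) = ∑ σ : Fin n → Bool, ∑ i, φ i (!σ i) :=
    (Equiv.sum_comp (hinv.toPerm _) fun σ : Fin n → Bool => ∑ i, φ i (σ i)).symm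
  rw [two_mul]
  nth_rewrite 2 [h1]
  rw [← Finset.sum_add_distrib]
  have h2 : ∀ σ : Fin n → Bool, ∑ i, φ i (σ i) + ∑ i, φ i (!σ i) = ∑ i, (φ i true + φ i false) := by
    intro σ
    rw [← Finset.sum_add_distrib]
    refine Finset.sum_congr rfl fun i _ => ?_
    cases σ i <;> simp [add_comm]
  simp [h2]

/-- Symmetrization with a single mixed sample: a random sign selects `2 g(z i)` or `-2 g(z' i)`,
whose average is `g(z i) - g(z' i)`. A supremum of averages is at most the average of the suprema.
For each sign pattern, `measurePreserving_ite_pi` makes the mixture an i.i.d. sample again. -/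
theorem penalizedSup_elim_le (hg : ∀ f z, g f z ∈ Set.Icc (0 : ℝ) 1) (hb : 0 ≤ b) {n : ℕ}
    (z z' : Fin n → Z) :
    penalizedSup g b (Sum.elim (fun _ : Fin n => (1 : ℝ)) fun _ : Fin n => -1) (Sum.elim z z') ≤
      (1 / 2 ^ n) * ∑ σ : Fin n → Bool,
        penalizedSup g b (fun i => 2 * (if σ i then 1 else -1)) fun i => if σ i then z i else z' i := by
  refine ciSup_le fun f => ?_
  have h := sum_signs_flip (n := n) fun i s =>
    (2 * (if s then (1 : ℝ) else -1)) * g f (if s then z i else z' i)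
  have h1 : ∑ i, Sum.elim (fun _ : Fin n => (1 : ℝ)) (fun _ : Fin n => -1) i *
      g f (Sum.elim z z' i) - b * (‖f‖ ^ 2 + 1) = (1 / 2 ^ n) * ∑ σ : Fin n → Bool,
        (∑ i, (2 * (if σ i then (1 : ℝ) else -1)) * g f (if σ i then z i else z' i) -
          b * (‖f‖ ^ 2 + 1)) := by
    rw [Finset.sum_sub_distrib]
    have h2 : ∑ _σ : Fin n → Bool, b * (‖f‖ ^ 2 + 1) = 2 ^ n * (b * (‖f‖ ^ 2 + 1)) := by simp
    rw [h2, Fintype.sum_sum_type, mul_sub, ← mul_assoc, one_div_mul_cancel (by positivity), one_mul]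
    congr 1
    have h3 : ∑ i, ((2 * (if true then (1 : ℝ) else -1)) * g f (if true then z i else z' i) +
        (2 * (if false then (1 : ℝ) else -1)) * g f (if false then z i else z' i)) =
        2 * (∑ i, (1 : ℝ) * g f (z i) + ∑ i, -1 * g f (z' i)) := by
      rw [← Finset.sum_add_distrib, Finset.mul_sum]
      refine Finset.sum_congr rfl fun i _ => ?_
      simp only [if_true, Bool.false_eq_true, if_false]
      ring
    rw [h3] at h
    simp only [Sum.elim_inl, Sum.elim_inr]
    generalize ∑ i, (1 : ℝ) * g f (z i) + ∑ i, -1 * g f (z' i) = A at h ⊢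
    rw [one_div, eq_inv_mul_iff_mul_eq₀ (by positivity)]
    linarith
  rw [h1]
  refine mul_le_mul_of_nonneg_left (Finset.sum_le_sum fun σ _ => ?_) (by positivity)
  exact le_penalizedSup hg hb _ _ f

end PenalizedSup

/-! ### Uniform deviation and a lower Chernoff bound -/

section Deviation

variable {E Z : Type*} [NormedAddCommGroup E] [InnerProductSpace ℝ E] {g : E → Z → ℝ} {b : ℝ}

open scoped RealInnerProductSpace in
theorem sum_penalizedSup_signs_le {d : ℕ} (hd : 0 < d)
    (hb : 0 < b) (e : Z → Fin d → E)
    (hlip : ∀ f f' z, |g f z - g f' z| ≤ ∑ j, |⟪e z j, f - f'⟫|) {n : ℕ} (w : Fin n → Z) :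
    ∑ σ : Fin n → Bool, penalizedSup g b (fun i => 2 * (if σ i then 1 else -1)) w ≤
      2 ^ n * (d / b * ∑ i, ∑ j, ‖e (w i) j‖ ^ 2 - b) := by
  refine le_of_forall_pos_le_add fun ε hε => ?_
  -- The supremum need not be attained; near-maximizers share a total error `ε`.
  have hch : ∀ σ : Fin n → Bool, ∃ f : E,
      penalizedSup g b (fun i => 2 * (if σ i then 1 else -1)) w - ε / 2 ^ n <
        ∑ i, (2 * (if σ i then 1 else -1)) * g f (w i) - b * (‖f‖ ^ 2 + 1) := fun σ =>
    exists_lt_of_lt_ciSup (sub_lt_self _ (by positivity))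
  choose F hF using hch
  have h := sum_signs_le_of_lipschitz hd hb n (fun i f => 2 * g f (w i))
    (fun i j => (2 : ℝ) • e (w i) j) (fun i f f' => by
      rw [← mul_sub, abs_mul, abs_two]
      refine (mul_le_mul_of_nonneg_left (hlip f f' (w i)) two_pos.le).trans_eq ?_
      rw [Finset.mul_sum]
      refine Finset.sum_congr rfl fun j _ => ?_
      rw [real_inner_smul_left, abs_mul, abs_two]) 0 F
  have hcard : ∑ _σ : Fin n → Bool, (ε / 2 ^ n + b) = ε + 2 ^ n * b := by
    simp
    field_simp
  calc _ ≤ ∑ σ : Fin n → Bool, ((⟪0, F σ⟫ - b * ‖F σ‖ ^ 2 +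
          ∑ i, (if σ i then 1 else -1) * (2 * g (F σ) (w i))) + ((ε / 2 ^ n + b) - 2 * b)) := by
        refine Finset.sum_le_sum fun σ _ => ?_
        have h1 := (hF σ).le
        have h2 : ∑ i, (2 * (if σ i then (1 : ℝ) else -1)) * g (F σ) (w i) =
            ∑ i, (if σ i then 1 else -1) * (2 * g (F σ) (w i)) :=
          Finset.sum_congr rfl fun i _ => by ring
        rw [h2] at h1
        rw [inner_zero_left]
        linarith
    _ ≤ _ := by
        rw [Finset.sum_add_distrib, Finset.sum_sub_distrib, hcard]
        refine (add_le_add_left h _).trans (le_of_eq ?_)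
        simp only [norm_zero, norm_smul, Real.norm_ofNat, mul_pow, ← Finset.mul_sum,
          Finset.sum_const, Finset.card_univ, Fintype.card_pi, Fintype.card_bool,
          Finset.prod_const, Fintype.card_fin, nsmul_eq_mul]
        push_cast
        field_simp
        ring

variable [MeasurableSpace Z]

-- The constant part `-b` of the penalty pays for the Rademacher term `(d / b) n E ∑ⱼ ‖e z j‖²`;
-- `hv` says exactly that it suffices.
open scoped RealInnerProductSpace in
theorem integral_penalizedSup_elim_nonpos (P : Measure Z) [IsProbabilityMeasure P]
    {d : ℕ} (hd : 0 < d) (hg : ∀ f z, g f z ∈ Set.Icc (0 : ℝ) 1)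
    (hb : 0 < b) (e : Z → Fin d → E)
    (hlip : ∀ f f' z, |g f z - g f' z| ≤ ∑ j, |⟪e z j, f - f'⟫|)
    (hmeas : ∀ (ι : Type) [Fintype ι] (c : ι → ℝ), Measurable (penalizedSup g b c))
    (hei : Integrable (fun z => ∑ j, ‖e z j‖ ^ 2) P) (n : ℕ)
    (hv : d * (n * ∫ z, ∑ j, ‖e z j‖ ^ 2 ∂P) ≤ b ^ 2) :
    ∫ p : (Fin n → Z) × (Fin n → Z),
      penalizedSup g b (Sum.elim (fun _ : Fin n => (1 : ℝ)) fun _ : Fin n => -1) (Sum.elim p.1 p.2)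
      ∂((Measure.pi fun _ => P).prod (Measure.pi fun _ => P)) ≤ 0 := by
  set Q := Measure.pi fun _ : Fin n => P
  have helim : Measurable fun p : (Fin n → Z) × (Fin n → Z) =>
      (Sum.elim p.1 p.2 : Fin n ⊕ Fin n → Z) := by
    refine measurable_pi_lambda _ fun i => ?_
    rcases i with i | i
    · exact measurable_fst.eval
    · exact measurable_snd.eval
  have hint : ∀ σ : Fin n → Bool,
      Integrable (penalizedSup g b fun i => 2 * (if σ i then 1 else -1)) Q := fun σ =>
    Integrable.of_bound (hmeas _ _).aestronglyMeasurable _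
      (.of_forall fun w => abs_penalizedSup_le hg hb.le _ w)
  have hmp := fun σ : Fin n → Bool => measurePreserving_ite_pi P σ
  have hcomp : ∀ σ : Fin n → Bool, ∫ p : (Fin n → Z) × (Fin n → Z),
      penalizedSup g b (fun i => 2 * (if σ i then 1 else -1))
        (fun i => if σ i then p.1 i else p.2 i) ∂(Q.prod Q) =
      ∫ w, penalizedSup g b (fun i => 2 * (if σ i then 1 else -1)) w ∂Q := by
    intro σ
    have := integral_map (hmp σ).aemeasurable
      (f := penalizedSup g b fun i => 2 * (if σ i then 1 else -1))
      (by rw [(hmp σ).map_eq]; exact (hint σ).aestronglyMeasurable)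
    rw [(hmp σ).map_eq] at this
    exact this.symm
  have hinti : ∀ i : Fin n, Integrable (fun w : Fin n → Z => ∑ j, ‖e (w i) j‖ ^ 2) Q := fun i =>
    integrable_comp_eval (μ := fun _ : Fin n => P) hei
  have hintv : ∀ i : Fin n, ∫ w : Fin n → Z, ∑ j, ‖e (w i) j‖ ^ 2 ∂Q =
      ∫ z, ∑ j, ‖e z j‖ ^ 2 ∂P := fun i =>
    integral_comp_eval (μ := fun _ : Fin n => P) hei.aestronglyMeasurable
  calc _ ≤ ∫ p : (Fin n → Z) × (Fin n → Z), (1 / 2 ^ n) * ∑ σ : Fin n → Bool,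
        penalizedSup g b (fun i => 2 * (if σ i then 1 else -1))
          (fun i => if σ i then p.1 i else p.2 i) ∂(Q.prod Q) := by
        refine integral_mono ?_ ?_ fun p => penalizedSup_elim_le hg hb.le p.1 p.2
        · exact Integrable.of_bound ((hmeas _ _).comp helim).aestronglyMeasurable _
            (.of_forall fun w => abs_penalizedSup_le hg hb.le _ _)
        · refine Integrable.const_mul (integrable_finsetSum _ fun σ _ => ?_) _
          exact (hmp σ).integrable_comp_of_integrable (hint σ)
    _ = (1 / 2 ^ n) * ∑ σ : Fin n → Bool,
          ∫ w, penalizedSup g b (fun i => 2 * (if σ i then 1 else -1)) w ∂Q := by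
        rw [integral_const_mul, integral_finsetSum]
        · simp_rw [hcomp]
        · exact fun σ _ => (hmp σ).integrable_comp_of_integrable (hint σ)
    _ = (1 / 2 ^ n) * ∫ w, ∑ σ : Fin n → Bool,
          penalizedSup g b (fun i => 2 * (if σ i then 1 else -1)) w ∂Q := by
        rw [integral_finsetSum _ fun σ _ => hint σ]
    _ ≤ (1 / 2 ^ n) * ∫ w : Fin n → Z, 2 ^ n * (d / b * ∑ i, ∑ j, ‖e (w i) j‖ ^ 2 - b) ∂Q := by
        refine mul_le_mul_of_nonneg_left (integral_mono (integrable_finsetSum _ fun σ _ => hint σ)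
          ?_ fun w => sum_penalizedSup_signs_le hd hb e hlip w) (by positivity)
        exact (((integrable_finsetSum _ fun i _ => hinti i).const_mul _).sub
          (integrable_const _)).const_mul _
    _ = d / b * (n * ∫ z, ∑ j, ‖e z j‖ ^ 2 ∂P) - b := by
        rw [integral_const_mul, ← mul_assoc, one_div_mul_cancel (by positivity), one_mul,
          integral_sub ((integrable_finsetSum _ fun i _ => hinti i).const_mul _)
            (integrable_const _), integral_const_mul, integral_finsetSum _ fun i _ => hinti i]
        simp [hintv]
    _ ≤ 0 := by
        rw [sub_nonpos, div_mul_eq_mul_div, div_le_iff₀ hb]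
        linarith

open scoped RealInnerProductSpace in
/-- A one-sided uniform deviation inequality for a class of `[0, 1]`-valued functions indexed by
a Hilbert space, with a quadratic penalty that absorbs the Rademacher complexity. -/
theorem exists_measurableSet_deviation_le (P : Measure Z) [IsProbabilityMeasure P]
    {d : ℕ} (hd : 0 < d) (hg : ∀ f z, g f z ∈ Set.Icc (0 : ℝ) 1) (hgm : ∀ f, Measurable (g f))
    (hb : 0 < b) (e : Z → Fin d → E)
    (hlip : ∀ f f' z, |g f z - g f' z| ≤ ∑ j, |⟪e z j, f - f'⟫|)
    (hmeas : ∀ (ι : Type) [Fintype ι] (c : ι → ℝ), Measurable (penalizedSup g b c))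
    (hei : Integrable (fun z => ∑ j, ‖e z j‖ ^ 2) P) (n : ℕ)
    (hv : d * (n * ∫ z, ∑ j, ‖e z j‖ ^ 2 ∂P) ≤ b ^ 2) {y : ℝ} (hy : 0 ≤ y) :
    ∃ B : Set (Fin n → Z), MeasurableSet B ∧
      (Measure.pi fun _ => P).real B ≤ Real.exp (-(2 * n * y ^ 2)) ∧
      ∀ z ∉ B, ∀ f, ∑ i, g f (z i) - n * ∫ w, g f w ∂P ≤ n * y + b * (‖f‖ ^ 2 + 1) := by
  classical
  set Q := Measure.pi fun _ : Fin n => P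
  set c : Fin n ⊕ Fin n → ℝ := Sum.elim (fun _ : Fin n => (1 : ℝ)) fun _ : Fin n => -1 with hc
  set W : (Fin n → Z) → (Fin n → Z) → ℝ := fun z z' => penalizedSup g b c (Sum.elim z z')
  have helim : Measurable fun p : (Fin n → Z) × (Fin n → Z) =>
      (Sum.elim p.1 p.2 : Fin n ⊕ Fin n → Z) := by
    refine measurable_pi_lambda _ fun i => ?_
    rcases i with i | i
    · exact measurable_fst.eval
    · exact measurable_snd.eval
  have hWm : Measurable fun p : (Fin n → Z) × (Fin n → Z) => W p.1 p.2 := (hmeas _ c).comp helim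
  set C := ∑ i, |c i| + b
  have hWC : ∀ z z', |W z z'| ≤ C := fun z z' => abs_penalizedSup_le hg hb.le _ _
  have hWi : Integrable (fun p : (Fin n → Z) × (Fin n → Z) => W p.1 p.2) (Q.prod Q) :=
    Integrable.of_bound hWm.aestronglyMeasurable C (.of_forall fun p => hWC _ _)
  have hWzi : ∀ z, Integrable (W z) Q := fun z =>
    Integrable.of_bound (hWm.comp measurable_prodMk_left).aestronglyMeasurable C
      (.of_forall fun p => hWC _ _)
  -- McDiarmid is applied to the mean over the ghost sample. It dominates the penalized deviation of
  -- every `f`, and its measurability needs only suprema involving finitely many evaluations.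
  set V : (Fin n → Z) → ℝ := fun z => ∫ z', W z z' ∂Q with hV
  have hVm : Measurable V :=
    (StronglyMeasurable.integral_prod_right' (ν := Q) hWm.stronglyMeasurable).measurable
  have hVC : ∀ z, |V z| ≤ C := fun z => by
    simpa using norm_integral_le_of_norm_le_const (μ := Q) (f := W z) (.of_forall (hWC z))
  have hVd : ∀ z i w, |V (Function.update z i w) - V z| ≤ 1 := by
    intro z i w
    have h1 : ∀ z', ‖W (Function.update z i w) z' - W z z'‖ ≤ 1 := fun z' => by
      have := penalizedSup_update_sub_le hg hb.le c (Sum.elim z z') (Sum.inl i) w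
      rw [← Sum.elim_update_left] at this
      refine this.trans_eq ?_
      simp [hc]
    rw [hV]
    simp only
    rw [← integral_sub (hWzi _) (hWzi _)]
    simpa using norm_integral_le_of_norm_le_const (μ := Q) (.of_forall h1)
  have hVE : ∫ z, V z ∂Q ≤ 0 := by
    rw [hV, ← integral_prod _ hWi]
    exact integral_penalizedSup_elim_nonpos P hd hg hb e hlip hmeas hei n hv
  refine ⟨{z | n * y ≤ V z}, measurableSet_le measurable_const hVm,
    measureReal_ge_le_of_bounded_differences P n V hVm C hVC hVd hVE hy, fun z hz f => ?_⟩
  have hgi : Integrable (g f) P := Integrable.of_bound (hgm f).aestronglyMeasurable 1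
    (.of_forall fun z => by rw [Real.norm_of_nonneg (hg f z).1]; exact (hg f z).2)
  have hgi' : ∀ i : Fin n, Integrable (fun w : Fin n → Z => g f (w i)) Q := fun i =>
    integrable_comp_eval (μ := fun _ : Fin n => P) hgi
  have hgv : ∀ i : Fin n, ∫ w : Fin n → Z, g f (w i) ∂Q = ∫ z, g f z ∂P := fun i =>
    integral_comp_eval (μ := fun _ : Fin n => P) hgi.aestronglyMeasurable
  have h1 : ∫ z' : Fin n → Z, (∑ i, g f (z i) - ∑ i, g f (z' i) - b * (‖f‖ ^ 2 + 1)) ∂Q ≤ V z := by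
    refine integral_mono (((integrable_const _).sub
      (integrable_finsetSum _ fun i _ => hgi' i)).sub (integrable_const _)) (hWzi z) fun z' => ?_
    refine le_trans (le_of_eq ?_) (le_penalizedSup hg hb.le c (Sum.elim z z') f)
    simp [hc, sub_eq_add_neg]
  have h3 : Integrable (fun z' : Fin n → Z => ∑ i, g f (z i) - ∑ i, g f (z' i)) Q :=
    (integrable_const _).sub (integrable_finsetSum _ fun i _ => hgi' i)
  rw [integral_sub h3 (integrable_const _), integral_sub (integrable_const _)
    (integrable_finsetSum _ fun i _ => hgi' i), integral_finsetSum _ fun i _ => hgi' i] at h1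
  simp only [hgv, integral_const, probReal_univ, one_smul, Finset.sum_const, Finset.card_univ,
    Fintype.card_fin, nsmul_eq_mul] at h1
  have h2 : V z < n * y := not_le.1 hz
  linarith

/-- Lower Chernoff bound for a sum of independent `[0, 1]`-valued variables. -/
theorem measureReal_sum_le_quarter_le (P : Measure Z) [IsProbabilityMeasure P] {h : Z → ℝ}
    (hm : Measurable h) (h01 : ∀ z, h z ∈ Set.Icc (0 : ℝ) 1) (n : ℕ) :
    (Measure.pi fun _ : Fin n => P).real {z | ∑ i, h (z i) ≤ n * (∫ z, h z ∂P) / 4} ≤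
      Real.exp (-(n * (∫ z, h z ∂P) / 3)) := by
  set m := ∫ z, h z ∂P
  have hhi : Integrable h P := Integrable.of_bound hm.aestronglyMeasurable 1
    (.of_forall fun z => by rw [Real.norm_of_nonneg (h01 z).1]; exact (h01 z).2)
  have hm0 : 0 ≤ m := integral_nonneg fun z => (h01 z).1
  have hsm : Measurable fun z : Fin n → Z => ∑ i, h (z i) := by fun_prop
  have hsB : ∀ z : Fin n → Z, |∑ i, h (z i)| ≤ n := fun z => by
    refine (Finset.abs_sum_le_sum_abs _ _).trans ?_
    refine (Finset.sum_le_sum (g := fun _ => (1 : ℝ)) fun i _ => ?_).trans (by simp)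
    rw [abs_of_nonneg (h01 _).1]; exact (h01 _).2
  -- The chord of `exp (-x)` on `[0, 1]` then lies below `1 - 5x/8`, and `5/8 - 1/4 = 3/8 ≥ 1/3`
  -- yields the stated exponent.
  have hexp : Real.exp (-1) ≤ 3 / 8 := by
    have := Real.exp_neg_one_lt_d9
    linarith
  have hstep : ∫ z, Real.exp (-1 * h z) ∂P ≤ Real.exp (-(5 / 8 * m)) := by
    calc _ ≤ ∫ z, (1 - 5 / 8 * h z) ∂P := by
          refine integral_mono (integrable_exp_mul_of_abs_le P hm (B := 1) (fun z => ?_) _)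
            ((integrable_const _).sub (hhi.const_mul _)) fun z => ?_
          · rw [abs_of_nonneg (h01 z).1]; exact (h01 z).2
          · have hc := convexOn_exp.2 (Set.mem_univ (-1 : ℝ)) (Set.mem_univ (0 : ℝ)) (h01 z).1
              (sub_nonneg.2 (h01 z).2) (by ring)
            simp only [smul_eq_mul, mul_zero, add_zero, Real.exp_zero, mul_one] at hc
            have := mul_le_mul_of_nonneg_left hexp (h01 z).1
            rw [mul_comm (-1)]
            simp only
            linarith
      _ = 1 - 5 / 8 * m := by
          rw [integral_sub (integrable_const _) (hhi.const_mul _), integral_const_mul]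
          simp [m]
      _ ≤ _ := by linarith [Real.add_one_le_exp (-(5 / 8 * m))]
  have hmgf : mgf (fun z : Fin n → Z => ∑ i, h (z i)) (Measure.pi fun _ : Fin n => P) (-1) ≤
      Real.exp (-(5 / 8 * m)) ^ n := by
    have : mgf (fun z : Fin n → Z => ∑ i, h (z i)) (Measure.pi fun _ : Fin n => P) (-1) =
        ∏ _i : Fin n, ∫ z, Real.exp (-1 * h z) ∂P := by
      rw [← integral_fintype_prod_eq_prod, mgf]
      congr 1 with z
      simp only
      rw [← Real.exp_sum, Finset.mul_sum]
    rw [this, Finset.prod_const, Finset.card_univ, Fintype.card_fin]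
    exact pow_le_pow_left₀ (integral_nonneg fun _ => Real.exp_nonneg _) hstep n
  refine (measure_le_le_exp_mul_mgf _ (t := -1) (by norm_num)
    (integrable_exp_mul_of_abs_le _ hsm hsB _)).trans ?_
  refine (mul_le_mul_of_nonneg_left hmgf (Real.exp_nonneg _)).trans ?_
  rw [← Real.exp_nat_mul, ← Real.exp_add]
  refine Real.exp_le_exp.2 ?_
  nlinarith [mul_nonneg (Nat.cast_nonneg (α := ℝ) n) hm0]

end Deviation

namespace VectorKernel

/-! ### Lipschitz and measurability properties of the margin -/

section Margin

variable {d : ℕ}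

theorem abs_margin_sub_le (hd : 2 ≤ d) (u v : EuclideanSpace ℝ (Fin d)) (c : Fin d) :
    |margin u c - margin v c| ≤ 2 * ∑ j, |u j - v j| := by
  have : Nontrivial (Fin d) := Fin.nontrivial_iff_two_le.2 hd
  obtain ⟨c', hc'⟩ := exists_ne c
  have : Nonempty {c' : Fin d // c' ≠ c} := ⟨⟨c', hc'⟩⟩
  have hle : ∀ j, |u j - v j| ≤ ∑ j, |u j - v j| := fun j =>
    Finset.single_le_sum (f := fun j => |u j - v j|) (fun _ _ => abs_nonneg _) (Finset.mem_univ j)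
  have h1 : (⨆ c' : {c' : Fin d // c' ≠ c}, u c') ≤
      (⨆ c' : {c' : Fin d // c' ≠ c}, v c') + ∑ j, |u j - v j| := by
    refine ciSup_le fun j => ?_
    have := le_ciSup (Set.finite_range fun c' : {c' : Fin d // c' ≠ c} => v c').bddAbove j
    have := (le_abs_self _).trans (hle j)
    linarith
  have h2 : (⨆ c' : {c' : Fin d // c' ≠ c}, v c') ≤
      (⨆ c' : {c' : Fin d // c' ≠ c}, u c') + ∑ j, |u j - v j| := by
    refine ciSup_le fun j => ?_
    have := le_ciSup (Set.finite_range fun c' : {c' : Fin d // c' ≠ c} => u c').bddAbove j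
    have := (neg_le_abs _).trans (hle j)
    linarith
  have h3 := abs_le.1 (hle c)
  rw [abs_le, margin, margin]
  constructor <;> linarith [h3.1, h3.2]

theorem measurable_margin : Measurable fun p : EuclideanSpace ℝ (Fin d) × Fin d =>
    margin p.1 p.2 := by
  refine measurable_from_prod_countable_left fun c => ?_
  unfold margin
  have hm : ∀ j : Fin d, Measurable fun u : EuclideanSpace ℝ (Fin d) => u j := fun j =>
    (measurable_pi_apply j).comp (WithLp.measurable_ofLp 2 (Fin d → ℝ))
  exact (hm c).sub (Measurable.iSup fun j : {c' : Fin d // c' ≠ c} => hm j)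

/-- The margin divided by `γ` and clamped to `[0, 1]`. -/
noncomputable def rampMargin (γ : ℝ) (u : EuclideanSpace ℝ (Fin d)) (c : Fin d) : ℝ :=
  max 0 (min 1 (margin u c / γ))

theorem rampMargin_mem_Icc (γ : ℝ) (u : EuclideanSpace ℝ (Fin d)) (c : Fin d) :
    rampMargin γ u c ∈ Set.Icc (0 : ℝ) 1 :=
  ⟨le_max_left _ _, max_le zero_le_one (min_le_left _ _)⟩

theorem abs_rampMargin_sub_le (hd : 2 ≤ d) {γ : ℝ} (hγ : 0 < γ) (u v : EuclideanSpace ℝ (Fin d))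
    (c : Fin d) : |rampMargin γ u c - rampMargin γ v c| ≤ 2 / γ * ∑ j, |u j - v j| := by
  have h1 : |rampMargin γ u c - rampMargin γ v c| ≤ |margin u c / γ - margin v c / γ| := by
    rw [rampMargin, rampMargin, max_comm 0, max_comm 0]
    refine (abs_max_sub_max_le_abs _ _ _).trans ?_
    exact (abs_min_sub_min_le_max _ _ _ _).trans (by simp)
  refine h1.trans ?_
  rw [← sub_div, abs_div, abs_of_pos hγ, div_mul_eq_mul_div]
  exact div_le_div_of_nonneg_right (abs_margin_sub_le hd u v c) hγ.le

theorem measurable_rampMargin (γ : ℝ) : Measurable fun p : EuclideanSpace ℝ (Fin d) × Fin d =>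
    rampMargin γ p.1 p.2 :=
  measurable_const.max (measurable_const.min (measurable_margin.div_const γ))

theorem continuous_rampMargin (hd : 2 ≤ d) {γ : ℝ} (hγ : 0 < γ) (c : Fin d) :
    Continuous fun u : EuclideanSpace ℝ (Fin d) => rampMargin γ u c := by
  rw [continuous_iff_continuousAt]
  intro v
  rw [ContinuousAt, tendsto_iff_dist_tendsto_zero]
  refine squeeze_zero (fun _ => dist_nonneg) (fun u => abs_rampMargin_sub_le hd hγ u v c) ?_
  have : Continuous fun u : EuclideanSpace ℝ (Fin d) => 2 / γ * ∑ j, |u j - v j| := by fun_prop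
  simpa using this.tendsto v

end Margin

/-! ### Kernel vectors and measurability in the RKHS -/

section RKHS

open scoped RealInnerProductSpace

variable {𝓧 : Type*} {d : ℕ} {k : 𝓧 → 𝓧 → Matrix (Fin d) (Fin d) ℝ}
  {H : Type*} [NormedAddCommGroup H] [InnerProductSpace ℝ H] [CompleteSpace H]
  [RKHS ℝ H 𝓧 (EuclideanSpace ℝ (Fin d))]

variable (H) in
/-- The element of `H` that represents the evaluation of the `j`-th coordinate at `x`. -/
noncomputable def kerVec (x : 𝓧) (j : Fin d) : H := RKHS.kerFun H x (EuclideanSpace.single j (1 : ℝ))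

theorem inner_kerVec (x : 𝓧) (j : Fin d) (f : H) : ⟪kerVec H x j, f⟫ = f x j := by
  simp [kerVec, EuclideanSpace.inner_single_left]

theorem kerVec_apply (hH : HasKernel H k) (x y : 𝓧) (i j : Fin d) :
    (kerVec H y j) x i = k x y i j := by
  rw [kerVec, RKHS.kerFun_apply, hH]
  simp [Matrix.ofLp_toEuclideanCLM]

theorem inner_kerVec_kerVec (hH : HasKernel H k) (x y : 𝓧) (i j : Fin d) :
    ⟪kerVec H x i, kerVec H y j⟫ = k x y i j := by
  rw [inner_kerVec, kerVec_apply hH]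

theorem norm_kerVec_sq (hH : HasKernel H k) (x : 𝓧) (j : Fin d) :
    ‖kerVec H x j‖ ^ 2 = k x x j j := by
  rw [← real_inner_self_eq_norm_sq, inner_kerVec_kerVec hH]

theorem sum_norm_kerVec_sq (hH : HasKernel H k) (x : 𝓧) :
    ∑ j, ‖kerVec H x j‖ ^ 2 = (k x x).trace := by
  simp [norm_kerVec_sq hH, Matrix.trace]

theorem topologicalClosure_span_kerVec :
    (Submodule.span ℝ (Set.range fun p : 𝓧 × Fin d => kerVec H p.1 p.2)).topologicalClosure = ⊤ := by
  rw [Submodule.topologicalClosure_eq_top_iff, Submodule.eq_bot_iff]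
  intro f hf
  ext x j
  rw [← inner_kerVec, ← inner_kerVec, inner_zero_right]
  exact (Submodule.mem_orthogonal _ _).1 hf _ (Submodule.subset_span ⟨(x, j), rfl⟩)

/-- Norm limits in `H` are pointwise limits, and kernel vectors span a dense subspace; no
separability of `H` is needed. -/
theorem measurable_coe [MeasurableSpace 𝓧] (hH : HasKernel H k)
    (hk : ∀ a b : Fin d, Measurable fun p : 𝓧 × 𝓧 => k p.1 p.2 a b) (f : H) :
    Measurable fun x => f x := by
  have hspan : ∀ g ∈ Submodule.span ℝ (Set.range fun p : 𝓧 × Fin d => kerVec H p.1 p.2),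
      Measurable fun x => g x := by
    intro g hg
    induction hg using Submodule.span_induction with
    | mem g hg =>
      obtain ⟨p, rfl⟩ := hg
      have : Measurable fun x => fun i => (kerVec H p.1 p.2) x i := by
        refine measurable_pi_lambda _ fun i => ?_
        simp only [kerVec_apply hH]
        exact (hk i p.2).comp measurable_prodMk_right
      exact (WithLp.measurable_toLp 2 (Fin d → ℝ)).comp this
    | zero => simp
    | add g g' _ _ h h' => simpa only [RKHS.coe_add] using h.add h'
    | smul a g _ h => simpa only [RKHS.coe_smul] using h.const_smul a
  have hf : f ∈ closure
      (Submodule.span ℝ (Set.range fun p : 𝓧 × Fin d => kerVec H p.1 p.2) : Set H) := by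
    rw [← Submodule.topologicalClosure_coe, topologicalClosure_span_kerVec]
    trivial
  obtain ⟨u, hu, hlim⟩ := mem_closure_iff_seq_limit.1 hf
  refine measurable_of_tendsto_metrizable (fun m => hspan _ (hu m)) (tendsto_pi_nhds.2 fun x => ?_)
  exact ((RKHS.continuous_eval x).tendsto f).comp hlim

variable (H) in
/-- The element `∑ i, ∑ j, a i j • kerVec H (x i) j` of `H`. -/
noncomputable def kerSum {ι : Type*} [Fintype ι] (x : ι → 𝓧) (a : ι → Fin d → ℝ) : H :=
  ∑ i, ∑ j, a i j • kerVec H (x i) j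

theorem kerSum_apply (hH : HasKernel H k) {ι : Type*} [Fintype ι] (x : ι → 𝓧)
    (a : ι → Fin d → ℝ) (y : 𝓧) (m : Fin d) :
    (kerSum H x a) y m = ∑ i, ∑ j, a i j * k y (x i) m j := by
  rw [← inner_kerVec, kerSum]
  simp [inner_sum, inner_smul_right, inner_kerVec_kerVec hH]

theorem norm_kerSum_sq (hH : HasKernel H k) {ι : Type*} [Fintype ι] (x : ι → 𝓧)
    (a : ι → Fin d → ℝ) :
    ‖kerSum H x a‖ ^ 2 = ∑ i, ∑ j, a i j * ∑ i', ∑ j', a i' j' * k (x i) (x i') j j' := by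
  rw [← real_inner_self_eq_norm_sq]
  nth_rewrite 1 [kerSum]
  simp [sum_inner, real_inner_smul_left, inner_kerVec, kerSum_apply hH]

/-- Finitely many evaluations of an element of `H` are those of an element of no larger norm
in the span of the kernel functions at the points. -/
theorem exists_kerSum_eq {ι : Type*} [Fintype ι] (x : ι → 𝓧) (f : H) :
    ∃ a : ι → Fin d → ℝ, (∀ i, (kerSum H x a) (x i) = f (x i)) ∧ ‖kerSum H x a‖ ≤ ‖f‖ := by
  set S := Submodule.span ℝ (Set.range fun p : ι × Fin d => kerVec H (x p.1) p.2)
  have : FiniteDimensional ℝ S := FiniteDimensional.span_of_finite ℝ (Set.finite_range _)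
  obtain ⟨a, ha⟩ := (Submodule.mem_span_range_iff_exists_fun ℝ).1 (S.starProjection_apply_mem f)
  have hsum : kerSum H x (fun i j => a (i, j)) = S.starProjection f := by
    rw [← ha, kerSum, Fintype.sum_prod_type]
  refine ⟨fun i j => a (i, j), fun i => ?_, ?_⟩
  · rw [hsum]
    ext j
    rw [← inner_kerVec, ← inner_kerVec, ← sub_eq_zero, ← inner_sub_right, ← neg_sub, inner_neg_right,
      neg_eq_zero]
    exact (Submodule.mem_orthogonal _ _).1 (S.sub_starProjection_mem_orthogonal f) _
      (Submodule.subset_span ⟨(i, j), rfl⟩)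
  · rw [hsum]
    exact S.norm_starProjection_apply_le f

theorem continuous_kerSum {ι : Type*} [Fintype ι] (x : ι → 𝓧) :
    Continuous fun a : ι → Fin d → ℝ => kerSum H x a := by
  unfold kerSum
  fun_prop

/-- By projection onto the kernel vectors at the sample points, the supremum over `H` reduces to
finitely many real coefficients. Continuity in these reduces it further to rational ones, hence to a
countable supremum. -/
theorem measurable_penalizedSup [MeasurableSpace 𝓧] (hH : HasKernel H k)
    (hk : ∀ a b : Fin d, Measurable fun p : 𝓧 × 𝓧 => k p.1 p.2 a b)
    {𝓨 : Type*} [MeasurableSpace 𝓨] {φ : EuclideanSpace ℝ (Fin d) → 𝓧 × 𝓨 → ℝ}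
    (hφ : Measurable fun p : EuclideanSpace ℝ (Fin d) × (𝓧 × 𝓨) => φ p.1 p.2)
    (hφc : ∀ z, Continuous fun u => φ u z) (hφ01 : ∀ u z, φ u z ∈ Set.Icc (0 : ℝ) 1)
    {b : ℝ} (hb : 0 ≤ b) {ι : Type*} [Fintype ι] (c : ι → ℝ) :
    Measurable (penalizedSup (fun (f : H) (z : 𝓧 × 𝓨) => φ (f z.1) z) b c) := by
  set g : H → 𝓧 × 𝓨 → ℝ := fun f z => φ (f z.1) z
  have hg : ∀ f z, g f z ∈ Set.Icc (0 : ℝ) 1 := fun f z => hφ01 _ _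
  set G : (ι → Fin d → ℝ) → (ι → 𝓧 × 𝓨) → ℝ := fun a w =>
    ∑ i, c i * g (kerSum H (fun i => (w i).1) a) (w i) -
      b * (‖kerSum H (fun i => (w i).1) a‖ ^ 2 + 1) with hG
  have hGm : ∀ a, Measurable (G a) := by
    intro a
    have hkm : ∀ (i i' : ι) (j j' : Fin d),
        Measurable fun w : ι → 𝓧 × 𝓨 => k (w i).1 (w i').1 j j' := fun i i' j j' =>
      (hk j j').comp ((measurable_pi_apply i).fst.prodMk (measurable_pi_apply i').fst)
    have hval : ∀ i, Measurable fun w : ι → 𝓧 × 𝓨 =>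
        (kerSum H (fun i => (w i).1) a) (w i).1 := by
      intro i
      have : Measurable fun w : ι → 𝓧 × 𝓨 => fun m =>
          (kerSum H (fun i => (w i).1) a) (w i).1 m := by
        refine measurable_pi_lambda _ fun m => ?_
        simp only [kerSum_apply hH]
        exact Finset.measurable_sum _ fun i' _ => Finset.measurable_sum _ fun j' _ =>
          (hkm i i' m j').const_mul _
      exact (WithLp.measurable_toLp 2 (Fin d → ℝ)).comp this
    refine Measurable.sub (Finset.measurable_sum _ fun i _ => Measurable.const_mul ?_ _) ?_
    · exact hφ.comp ((hval i).prodMk (measurable_pi_apply i))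
    · simp only [norm_kerSum_sq hH]
      refine Measurable.const_mul (Measurable.add_const ?_ _) _
      exact Finset.measurable_sum _ fun i _ => Finset.measurable_sum _ fun j _ =>
        Measurable.const_mul (Finset.measurable_sum _ fun i' _ =>
          Finset.measurable_sum _ fun j' _ => (hkm i i' j j').const_mul _) _
  have hGc : ∀ w, Continuous fun a => G a w := by
    intro w
    have h1 := continuous_kerSum (H := H) fun i => (w i).1
    refine Continuous.sub (continuous_finsetSum _ fun i _ => continuous_const.mul ?_) (by fun_prop)
    exact (hφc (w i)).comp ((RKHS.continuous_eval _).comp h1)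
  have hdense : DenseRange fun (a : ι → Fin d → ℚ) i j => (a i j : ℝ) := by
    have h1 : DenseRange fun (a : Fin d → ℚ) j => (a j : ℝ) :=
      DenseRange.piMap fun _ => Rat.denseRange_cast
    exact DenseRange.piMap (f := fun _ : ι => fun (a : Fin d → ℚ) j => (a j : ℝ)) fun _ => h1
  have heq : penalizedSup g b c = fun w => ⨆ a : ι → Fin d → ℚ, G (fun i j => (a i j : ℝ)) w := by
    funext w
    have hle : ∀ a, G a w ≤ penalizedSup g b c w := fun a => le_penalizedSup hg hb c w _
    have hbdd : BddAbove (Set.range fun a : ι → Fin d → ℚ => G (fun i j => (a i j : ℝ)) w) :=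
      ⟨_, by rintro _ ⟨a, rfl⟩; exact hle _⟩
    refine le_antisymm (ciSup_le fun f => ?_) (ciSup_le fun a => hle _)
    obtain ⟨a, ha, hn⟩ := exists_kerSum_eq (fun i => (w i).1) f
    have hmem : ∀ a, G a w ≤ ⨆ a : ι → Fin d → ℚ, G (fun i j => (a i j : ℝ)) w := by
      intro a
      refine hdense.induction_on (p := fun a => G a w ≤ _) a
        (isClosed_le (hGc w) continuous_const) fun q => ?_
      exact le_ciSup hbdd q
    refine le_trans ?_ (hmem a)
    simp only [hG, g]
    have h1 : ∑ i, c i * φ ((kerSum H (fun i => (w i).1) a) (w i).1) (w i) =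
        ∑ i, c i * φ (f (w i).1) (w i) := Finset.sum_congr rfl fun i _ => by rw [ha i]
    rw [h1]
    gcongr
  rw [heq]
  exact Measurable.iSup fun a => hGm _

end RKHS

end VectorKernel

/-- Intermediate value theorem in `u = log t`: by dominated convergence the integral tends to `0`
and `1` at the two ends. This sets the truncation level of the kernel trace. -/
theorem exists_integral_min_mul_eq {Z : Type*} [MeasurableSpace Z] (P : Measure Z)
    [IsProbabilityMeasure P] {q : Z → ℝ} (hq : Measurable q) (hpos : ∀ᵐ z ∂P, 0 < q z)
    {r : ℝ} (h0 : 0 < r) (h1 : r < 1) : ∃ t : ℝ, 0 < t ∧ ∫ z, min (t * q z) 1 ∂P = r := by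
  set φ : ℝ → ℝ := fun u => ∫ z, min (Real.exp u * q z) 1 ∂P with hφ
  have hm : ∀ u, AEStronglyMeasurable (fun z => min (Real.exp u * q z) 1) P := fun u =>
    ((hq.const_mul _).min measurable_const).aestronglyMeasurable
  have hbd : ∀ u, ∀ᵐ z ∂P, ‖min (Real.exp u * q z) 1‖ ≤ 1 := fun u => by
    filter_upwards [hpos] with z hz
    rw [Real.norm_of_nonneg (by positivity)]
    exact min_le_right _ _
  have hc : Continuous φ := by
    refine continuous_of_dominated hm hbd (integrable_const 1) (.of_forall fun z => ?_)
    fun_prop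
  have hbot : Filter.Tendsto φ Filter.atBot (nhds 0) := by
    have := tendsto_integral_filter_of_dominated_convergence (μ := P) (l := Filter.atBot)
      (F := fun u z => min (Real.exp u * q z) 1) (f := fun _ => 0) (fun _ => 1)
      (.of_forall hm) (.of_forall hbd) (integrable_const 1) (.of_forall fun z => by
        have := ((Real.tendsto_exp_atBot.mul_const (q z)).min (tendsto_const_nhds (x := (1 : ℝ))))
        simpa using this)
    simpa using this
  have htop : Filter.Tendsto φ Filter.atTop (nhds 1) := by
    have := tendsto_integral_filter_of_dominated_convergence (μ := P) (l := Filter.atTop)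
      (F := fun u z => min (Real.exp u * q z) 1) (f := fun _ => 1) (fun _ => 1)
      (.of_forall hm) (.of_forall hbd) (integrable_const 1) (by
        filter_upwards [hpos] with z hz
        refine tendsto_const_nhds.congr' ?_
        filter_upwards [(Real.tendsto_exp_atTop.atTop_mul_const hz).eventually_ge_atTop 1] with u hu
        exact (min_eq_right hu).symm)
    simpa using this
  obtain ⟨u, hu⟩ := mem_range_of_exists_le_of_exists_ge hc
    ((hbot.eventually_le_const h0).exists) ((htop.eventually_const_le h1).exists)
  exact ⟨Real.exp u, Real.exp_pos u, hu⟩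

namespace VectorKernel

/-! ### Minimal norm interpolation and the regularized minimizer -/

section Interpolation

open scoped RealInnerProductSpace

variable {𝓧 : Type*} {d : ℕ} {k : 𝓧 → 𝓧 → Matrix (Fin d) (Fin d) ℝ}
  {H : Type*} [NormedAddCommGroup H] [InnerProductSpace ℝ H] [CompleteSpace H]
  [RKHS ℝ H 𝓧 (EuclideanSpace ℝ (Fin d))]

theorem isUnit_det_kernelMatrix {n : ℕ} {x : Fin n → 𝓧}
    (hK : (kernelMatrix k x).rank = n * d) : IsUnit (kernelMatrix k x).det := by
  rw [← Matrix.isUnit_iff_isUnit_det, ← Matrix.mulVec_surjective_iff_isUnit]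
  have h : LinearMap.range (kernelMatrix k x).mulVecLin = ⊤ := by
    refine Submodule.eq_top_of_finrank_eq ?_
    rw [← Matrix.rank, hK]
    simp
  exact LinearMap.range_eq_top.1 h

/-- The minimal norm interpolant of the targets has squared norm `Yᵀ K⁻¹ Y`. -/
theorem exists_interpolant (hH : HasKernel H k) {n : ℕ} {x : Fin n → 𝓧}
    (hK : (kernelMatrix k x).rank = n * d) (y : Fin n → EuclideanSpace ℝ (Fin d)) :
    ∃ g : H, (∀ i, g (x i) = y i) ∧ ‖g‖ ^ 2 = supervisionComplexity k x y := by
  set v := (kernelMatrix k x)⁻¹.mulVec (concatTargets y) with hv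
  have hKv : (kernelMatrix k x).mulVec v = concatTargets y := by
    rw [hv, Matrix.mulVec_mulVec, Matrix.mul_nonsing_inv _ (isUnit_det_kernelMatrix hK),
      Matrix.one_mulVec]
  have hval : ∀ i m, ∑ i', ∑ j, v (i', j) * k (x i) (x i') m j = y i m := by
    intro i m
    have := congrFun hKv (i, m)
    rw [Matrix.mulVec, dotProduct, Fintype.sum_prod_type] at this
    rw [show y i m = concatTargets y (i, m) from rfl, ← this]
    simp [kernelMatrix, mul_comm]
  refine ⟨kerSum H x fun i j => v (i, j), fun i => ?_, ?_⟩
  · ext m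
    rw [kerSum_apply hH, hval]
  · rw [norm_kerSum_sq hH, supervisionComplexity, ← hv, dotProduct, Fintype.sum_prod_type]
    simp only [hval]
    simp [concatTargets, mul_comm]

theorem supervisionComplexity_nonneg (hH : HasKernel H k) {n : ℕ} {x : Fin n → 𝓧}
    (hK : (kernelMatrix k x).rank = n * d) (y : Fin n → EuclideanSpace ℝ (Fin d)) :
    0 ≤ supervisionComplexity k x y := by
  obtain ⟨g, -, hg⟩ := exists_interpolant (H := H) hH hK y
  rw [← hg]
  positivity

theorem norm_sq_le_supervisionComplexity (hH : HasKernel H k) {n : ℕ} {x : Fin n → 𝓧}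
    (hK : (kernelMatrix k x).rank = n * d) {𝓨 : Set (EuclideanSpace ℝ (Fin d))} (y : Fin n → 𝓨)
    {ℓ : EuclideanSpace ℝ (Fin d) → 𝓨 → ℝ} (hℓ_nonneg : ∀ u y, 0 ≤ ℓ u y)
    (hℓ_self : ∀ y : 𝓨, ℓ (y : EuclideanSpace ℝ (Fin d)) y = 0) {lam : ℝ} (hlam : 0 < lam) {f : H}
    (hf : IsMinOn (regularizedRisk (H := H) ℓ lam x y) Set.univ f) :
    ‖f‖ ^ 2 ≤ supervisionComplexity k x fun i => (y i : EuclideanSpace ℝ (Fin d)) := by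
  obtain ⟨g, hgy, hg⟩ := exists_interpolant (H := H) hH hK fun i => (y i : EuclideanSpace ℝ (Fin d))
  have h := hf (Set.mem_univ g)
  simp only [Set.mem_ofPred_eq, regularizedRisk, hgy, hℓ_self, Finset.sum_const_zero, mul_zero,
    zero_add, hg] at h
  have : 0 ≤ (1 / (n : ℝ)) * ∑ i, ℓ (f (x i)) (y i) :=
    mul_nonneg (by positivity) (Finset.sum_nonneg fun i _ => hℓ_nonneg _ _)
  nlinarith

theorem trace_kernelMatrix {n : ℕ} (x : Fin n → 𝓧) :
    (kernelMatrix k x).trace = ∑ i, (k (x i) (x i)).trace := by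
  simp [Matrix.trace, kernelMatrix, Fintype.sum_prod_type]

theorem trace_nonneg (hH : HasKernel H k) (x : 𝓧) : 0 ≤ (k x x).trace := by
  rw [← sum_norm_kerVec_sq (H := H) hH]
  positivity

/-- A zero diagonal entry forces the kernel vector, hence a whole row of the kernel matrix, to
vanish. -/
theorem kernel_diag_pos (hH : HasKernel H k) {n : ℕ} {x : Fin n → 𝓧}
    (hK : (kernelMatrix k x).rank = n * d) (i : Fin n) (j : Fin d) : 0 < k (x i) (x i) j j := by
  rw [← norm_kerVec_sq (H := H) hH]
  refine pow_pos (norm_pos_iff.2 fun h => ?_) 2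
  refine (isUnit_det_kernelMatrix hK).ne_zero (Matrix.det_eq_zero_of_row_eq_zero (i, j) fun p => ?_)
  rw [kernelMatrix, Matrix.of_apply, ← inner_kerVec_kerVec (H := H) hH, h, inner_zero_left]

theorem trace_pos (hH : HasKernel H k) (hd : 0 < d) {n : ℕ} {x : Fin n → 𝓧}
    (hK : (kernelMatrix k x).rank = n * d) (i : Fin n) : 0 < (k (x i) (x i)).trace := by
  have : Nonempty (Fin d) := ⟨⟨0, hd⟩⟩
  exact Finset.sum_pos (fun j _ => kernel_diag_pos (H := H) hH hK i j) Finset.univ_nonempty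

end Interpolation

/-! ### Margin bound uniform over the RKHS -/

section Bound

open scoped RealInnerProductSpace

variable {𝓧 : Type*} [MeasurableSpace 𝓧] {d : ℕ} {k : 𝓧 → 𝓧 → Matrix (Fin d) (Fin d) ℝ}
  {H : Type*} [NormedAddCommGroup H] [InnerProductSpace ℝ H] [CompleteSpace H]
  [RKHS ℝ H 𝓧 (EuclideanSpace ℝ (Fin d))]

/-- A margin bound that holds simultaneously for all elements of the RKHS. The points where the
kernel is large are treated separately, so that no bound on the kernel is needed. -/
theorem exists_measurableSet_margin_bound (hH : HasKernel H k)
    (hk : ∀ a b : Fin d, Measurable fun p : 𝓧 × 𝓧 => k p.1 p.2 a b) (hd : 2 ≤ d)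
    {𝓨 : Type*} [MeasurableSpace 𝓨] {cls : 𝓨 → Fin d} (hcls : Measurable cls)
    (P : Measure (𝓧 × 𝓨)) [IsProbabilityMeasure P]
    (hpos : ∀ᵐ z ∂P, 0 < (k z.1 z.1).trace) {n : ℕ} (hn : 0 < n) {γ δ : ℝ} (hγ : 0 < γ)
    (hδ : 0 < δ) (hδ1 : δ < 1) (hy : √(Real.log (2 / δ) / (2 * n)) ≤ 1 / 3) :
    ∃ B : Set (Fin n → 𝓧 × 𝓨), MeasurableSet B ∧ (Measure.pi fun _ => P).real B ≤ δ ∧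
      ∀ z ∉ B, ∀ f : H, P.real {z | margin (f z.1) (cls z.2) ≤ 0} ≤
        (1 / (n : ℝ)) * ∑ i, Set.indicator {z : 𝓧 × 𝓨 | margin (f z.1) (cls z.2) ≤ γ}
            (fun _ => (1 : ℝ)) (z i)
          + 4 * d * (‖f‖ ^ 2 + 1) / (γ * n) * √(∑ i, (k (z i).1 (z i).1).trace)
          + 3 * √(Real.log (2 / δ) / (2 * n)) := by
  have hnR : (0 : ℝ) < n := Nat.cast_pos.2 hn
  have hdR : (2 : ℝ) ≤ d := by exact_mod_cast hd
  set L := Real.log (2 / δ)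
  have hL : 0 < L := Real.log_pos (by rw [lt_div_iff₀ hδ]; linarith)
  set y := √(L / (2 * n))
  have hy0 : 0 < y := Real.sqrt_pos.2 (by positivity)
  have hy2 : 2 * n * y ^ 2 = L := by
    rw [Real.sq_sqrt (by positivity)]
    field_simp
  have hexpL : Real.exp (-L) = δ / 2 := by
    rw [Real.exp_neg, Real.exp_log (by positivity), inv_div]
  -- Then `n r / 3 = 2 n y² = L`, so the Chernoff event fails with probability at most `δ / 2`; and
  -- `y ≤ 1/3` gives `r < 1` and `r ≤ 2y`.
  set r := 6 * y ^ 2 with hr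
  have hr0 : 0 < r := by positivity
  have hr1 : r < 1 := by nlinarith
  set q : 𝓧 × 𝓨 → ℝ := fun z => (k z.1 z.1).trace with hq
  have hqm : Measurable q := by
    have : Measurable fun x : 𝓧 => (k x x).trace :=
      Finset.measurable_sum _ fun j _ => (hk j j).comp (measurable_id.prodMk measurable_id)
    exact this.comp measurable_fst
  have hq0 : ∀ z, 0 ≤ q z := fun z => trace_nonneg (H := H) hH z.1
  obtain ⟨t, ht, htr⟩ := exists_integral_min_mul_eq P hqm hpos hr0 hr1
  have hmm : Measurable fun z => min (t * q z) 1 := (hqm.const_mul t).min measurable_const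
  have hm01 : ∀ z, min (t * q z) 1 ∈ Set.Icc (0 : ℝ) 1 := fun z =>
    ⟨le_min (mul_nonneg ht.le (hq0 z)) zero_le_one, min_le_right _ _⟩
  have hmi : Integrable (fun z => min (t * q z) 1) P :=
    Integrable.of_bound hmm.aestronglyMeasurable 1 (.of_forall fun z => by
      rw [Real.norm_of_nonneg (hm01 z).1]; exact (hm01 z).2)
  have hlight : MeasurableSet {z | t * q z ≤ 1} := measurableSet_le (hqm.const_mul t) measurable_const
  -- Where the kernel is large the value is the constant `1`, which does not depend on `f` and so
  -- contributes nothing to the complexity.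
  set φ : EuclideanSpace ℝ (Fin d) → 𝓧 × 𝓨 → ℝ := fun u z =>
    if t * q z ≤ 1 then rampMargin γ u (cls z.2) else 1 with hφ
  have hφm : Measurable fun p : EuclideanSpace ℝ (Fin d) × (𝓧 × 𝓨) => φ p.1 p.2 :=
    Measurable.ite (measurable_snd hlight) ((measurable_rampMargin γ).comp
      (measurable_fst.prodMk (hcls.comp measurable_snd.snd))) measurable_const
  have hφc : ∀ z, Continuous fun u => φ u z := by
    intro z
    by_cases hz : t * q z ≤ 1
    · simpa [hφ, hz] using continuous_rampMargin hd hγ (cls z.2)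
    · simpa [hφ, hz] using continuous_const
  have hφ01 : ∀ u z, φ u z ∈ Set.Icc (0 : ℝ) 1 := by
    intro u z
    by_cases hz : t * q z ≤ 1
    · simpa [hφ, hz] using rampMargin_mem_Icc γ u (cls z.2)
    · simp [hφ, hz]
  set g : H → 𝓧 × 𝓨 → ℝ := fun f z => φ (f z.1) z with hg
  have hg01 : ∀ f z, g f z ∈ Set.Icc (0 : ℝ) 1 := fun f z => hφ01 _ z
  have hfm : ∀ f : H, Measurable fun x => f x := fun f => measurable_coe hH hk f
  have hgm : ∀ f, Measurable (g f) := fun f =>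
    hφm.comp (((hfm f).comp measurable_fst).prodMk measurable_id)
  have hgi : ∀ f, Integrable (g f) P := fun f =>
    Integrable.of_bound (hgm f).aestronglyMeasurable 1 (.of_forall fun z => by
      rw [Real.norm_of_nonneg (hg01 f z).1]; exact (hg01 f z).2)
  set e : 𝓧 × 𝓨 → Fin d → H := fun z j => if t * q z ≤ 1 then (2 / γ) • kerVec H z.1 j else 0 with he
  have hlip : ∀ f f' z, |g f z - g f' z| ≤ ∑ j, |⟪e z j, f - f'⟫| := by
    intro f f' z
    by_cases hz : t * q z ≤ 1
    · have := abs_rampMargin_sub_le hd hγ (f z.1) (f' z.1) (cls z.2)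
      simp only [hg, hφ, he, hz, if_true]
      refine this.trans (le_of_eq ?_)
      rw [Finset.mul_sum]
      refine Finset.sum_congr rfl fun j _ => ?_
      rw [real_inner_smul_left, inner_sub_right, inner_kerVec, inner_kerVec, abs_mul,
        abs_of_pos (div_pos two_pos hγ)]
    · simp [hg, hφ, he, hz]
  have hesq : ∀ z, ∑ j, ‖e z j‖ ^ 2 = if t * q z ≤ 1 then (2 / γ) ^ 2 * q z else 0 := by
    intro z
    by_cases hz : t * q z ≤ 1
    · have hez : ∀ j, ‖e z j‖ ^ 2 = (2 / γ) ^ 2 * ‖kerVec H z.1 j‖ ^ 2 := fun j => by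
        simp only [he]
        rw [if_pos hz, norm_smul, mul_pow, Real.norm_of_nonneg (by positivity)]
      rw [if_pos hz, Finset.sum_congr rfl fun j _ => hez j, ← Finset.mul_sum,
        sum_norm_kerVec_sq hH]
    · simp [he, hz]
  have hele : ∀ z, ∑ j, ‖e z j‖ ^ 2 ≤ (2 / γ) ^ 2 / t * min (t * q z) 1 := by
    intro z
    rw [hesq]
    by_cases hz : t * q z ≤ 1
    · rw [if_pos hz, min_eq_left hz]
      refine le_of_eq ?_
      field_simp
    · rw [if_neg hz]
      exact mul_nonneg (by positivity) (hm01 z).1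
  have hem : Measurable fun z => ∑ j, ‖e z j‖ ^ 2 := by
    simp only [hesq]
    exact Measurable.ite hlight (hqm.const_mul _) measurable_const
  have hei : Integrable (fun z => ∑ j, ‖e z j‖ ^ 2) P := by
    refine (hmi.const_mul ((2 / γ) ^ 2 / t)).mono' hem.aestronglyMeasurable (.of_forall fun z => ?_)
    rw [Real.norm_of_nonneg (by positivity)]
    exact hele z
  -- The deviation bound asks for `b² ≥ 4 d n r / (γ² t)`; using `d²` for `d` gives the factor `d`
  -- of the claim.
  set b := 2 * d * √(n * r / t) / γ with hb
  have hb0 : 0 < b := by positivity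
  have hv : d * (n * ∫ z, ∑ j, ‖e z j‖ ^ 2 ∂P) ≤ b ^ 2 := by
    have h1 : ∫ z, ∑ j, ‖e z j‖ ^ 2 ∂P ≤ (2 / γ) ^ 2 / t * r := by
      rw [← htr, ← integral_const_mul]
      exact integral_mono hei (hmi.const_mul _) hele
    calc d * (n * ∫ z, ∑ j, ‖e z j‖ ^ 2 ∂P) ≤ d * (n * ((2 / γ) ^ 2 / t * r)) := by gcongr
      _ = d * (4 * (n * r / t) / γ ^ 2) := by ring
      _ ≤ d ^ 2 * (4 * (n * r / t) / γ ^ 2) := by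
          refine mul_le_mul_of_nonneg_right ?_ (by positivity)
          nlinarith
      _ = b ^ 2 := by
          rw [hb, div_pow, mul_pow, Real.sq_sqrt (by positivity)]
          ring
  obtain ⟨B₁, hB₁m, hB₁, hdev⟩ := exists_measurableSet_deviation_le P (by omega) hg01 hgm hb0 e hlip
    (fun ι _ c => measurable_penalizedSup hH hk hφm hφc hφ01 hb0.le c) hei n hv hy0.le
  have hB₂ := measureReal_sum_le_quarter_le P hmm hm01 n
  rw [htr] at hB₂
  set B₂ := {z : Fin n → 𝓧 × 𝓨 | ∑ i, min (t * q (z i)) 1 ≤ n * r / 4}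
  have hB₂m : MeasurableSet B₂ := by
    refine measurableSet_le (Finset.measurable_sum _ fun i _ => ?_) measurable_const
    exact hmm.comp (measurable_pi_apply i)
  refine ⟨B₁ ∪ B₂, hB₁m.union hB₂m, ?_, fun z hz f => ?_⟩
  · refine (measureReal_union_le _ _).trans ?_
    rw [hy2, hexpL] at hB₁
    rw [show n * r / 3 = L by rw [← hy2, hr]; ring, hexpL] at hB₂
    linarith
  · rw [Set.mem_union, not_or] at hz
    have h1 := hdev z hz.1 f
    have h2 : n * r / 4 < ∑ i, min (t * q (z i)) 1 := not_le.1 hz.2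
    -- Outside the Chernoff event `t * ∑ q (z i) > n r / 4`, which trades the deterministic scale
    -- for the empirical trace at the cost of a factor two.
    have h3 : √(n * r / t) / 2 ≤ √(∑ i, q (z i)) := by
      refine Real.le_sqrt_of_sq_le ?_
      rw [div_pow, Real.sq_sqrt (by positivity)]
      have : ∑ i, min (t * q (z i)) 1 ≤ t * ∑ i, q (z i) := by
        rw [Finset.mul_sum]
        exact Finset.sum_le_sum fun i _ => min_le_left _ _
      rw [div_div, div_le_iff₀ (by positivity)]
      linarith
    have h4 : b * (‖f‖ ^ 2 + 1) / n ≤ 4 * d * (‖f‖ ^ 2 + 1) / (γ * n) * √(∑ i, q (z i)) := by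
      calc b * (‖f‖ ^ 2 + 1) / n = 4 * d * (‖f‖ ^ 2 + 1) / (γ * n) * (√(n * r / t) / 2) := by
            rw [hb]; field_simp; ring
        _ ≤ _ := by gcongr
    have hmar : Measurable fun z : 𝓧 × 𝓨 => margin (f z.1) (cls z.2) :=
      measurable_margin.comp (((hfm f).comp measurable_fst).prodMk (hcls.comp measurable_snd))
    -- At a light misclassified point `g f` vanishes; at a heavy one `min (t * q) 1 = 1` covers the
    -- indicator.
    have h5 : P.real {z | margin (f z.1) (cls z.2) ≤ 0} ≤ 1 - ∫ w, g f w ∂P + r := by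
      have hS : MeasurableSet {z : 𝓧 × 𝓨 | margin (f z.1) (cls z.2) ≤ 0} :=
        measurableSet_le hmar measurable_const
      rw [← integral_indicator_one hS, ← htr]
      have h6 : ∫ w, (1 - g f w + min (t * q w) 1) ∂P =
          1 - ∫ w, g f w ∂P + ∫ w, min (t * q w) 1 ∂P := by
        have h7 : Integrable (fun w => 1 - g f w) P := (integrable_const _).sub (hgi f)
        rw [integral_add h7 hmi, integral_sub (integrable_const _) (hgi f)]
        simp
      rw [← h6]
      refine integral_mono ((integrable_const (1 : ℝ)).indicator hS)
        (((integrable_const _).sub (hgi f)).add hmi) fun w => ?_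
      have hgw := hg01 f w
      have hmw := hm01 w
      by_cases hw : margin (f w.1) (cls w.2) ≤ 0
      · rw [Set.indicator_of_mem (show w ∈ {z : 𝓧 × 𝓨 | margin (f z.1) (cls z.2) ≤ 0} from hw)]
        by_cases hl : t * q w ≤ 1
        · have : g f w = 0 := by
            simp only [hg, hφ, hl, if_true, rampMargin]
            exact max_eq_left ((min_le_right _ _).trans (div_nonpos_of_nonpos_of_nonneg hw hγ.le))
          simp only [this, Pi.one_apply]
          linarith [hmw.1]
        · simp only [min_eq_right (not_le.1 hl).le, Pi.one_apply]
          linarith [hgw.2]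
      · rw [Set.indicator_of_notMem
          (show w ∉ {z : 𝓧 × 𝓨 | margin (f z.1) (cls z.2) ≤ 0} from hw)]
        simp only
        linarith [hgw.2, hmw.1]
    have h6 : n - ∑ i, g f (z i) ≤ ∑ i, Set.indicator {z : 𝓧 × 𝓨 | margin (f z.1) (cls z.2) ≤ γ}
        (fun _ => (1 : ℝ)) (z i) := by
      have : (n : ℝ) - ∑ i, g f (z i) = ∑ i, (1 - g f (z i)) := by
        simp [Finset.sum_sub_distrib]
      rw [this]
      refine Finset.sum_le_sum fun i _ => ?_
      by_cases hw : margin (f (z i).1) (cls (z i).2) ≤ γ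
      · rw [Set.indicator_of_mem
          (show z i ∈ {z : 𝓧 × 𝓨 | margin (f z.1) (cls z.2) ≤ γ} from hw)]
        linarith [(hg01 f (z i)).1]
      · rw [Set.indicator_of_notMem
          (show z i ∉ {z : 𝓧 × 𝓨 | margin (f z.1) (cls z.2) ≤ γ} from hw)]
        have : g f (z i) = 1 := by
          by_cases hl : t * q (z i) ≤ 1
          · simp only [hg, hφ, hl, if_true, rampMargin]
            have : 1 ≤ margin (f (z i).1) (cls (z i).2) / γ := by
              rw [le_div_iff₀ hγ]; linarith [not_le.1 hw]
            rw [min_eq_left this, max_eq_right zero_le_one]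
          · simp [hg, hφ, hl]
        linarith
    have h7 : 1 - ∫ w, g f w ∂P ≤ (1 / (n : ℝ)) * (n - ∑ i, g f (z i)) + y +
        b * (‖f‖ ^ 2 + 1) / n := by
      rw [← mul_le_mul_iff_right₀ hnR]
      have : (n : ℝ) * ((1 / (n : ℝ)) * (n - ∑ i, g f (z i)) + y + b * (‖f‖ ^ 2 + 1) / n) =
          n - ∑ i, g f (z i) + n * y + b * (‖f‖ ^ 2 + 1) := by
        field_simp
      rw [this]
      linarith
    have h8 := mul_le_mul_of_nonneg_left h6 (one_div_nonneg.2 hnR.le)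
    have h9 : r ≤ 2 * y := by nlinarith
    linarith

end Bound

end VectorKernel

/-! ### Assembly of the generalization bound -/

theorem theorem2
    {Ω 𝓧 : Type*} [MeasurableSpace Ω] [MeasurableSpace 𝓧]
    {n d : ℕ} (hn : 1 ≤ n) (hd : 2 ≤ d)
    -- the kernel and its RKHS
    (k : 𝓧 → 𝓧 → Matrix (Fin d) (Fin d) ℝ) (hk : VectorKernel.IsPositiveKernel k)
    (hk_meas : ∀ a b : Fin d, Measurable fun p : 𝓧 × 𝓧 => k p.1 p.2 a b)
    (κ : ℝ) (hκ : IsLUB (Set.range fun p : 𝓧 × Fin d => k p.1 p.1 p.2 p.2) κ)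
    (H : Type*) [NormedAddCommGroup H] [InnerProductSpace ℝ H] [CompleteSpace H]
    [RKHS ℝ H 𝓧 (EuclideanSpace ℝ (Fin d))] (hH : VectorKernel.HasKernel H k)
    -- the targets, and the class that a target encodes
    (𝓨 : Set (EuclideanSpace ℝ (Fin d))) (cls : 𝓨 → Fin d) (hcls : Measurable cls)
    -- the i.i.d. sample
    (P : Measure (𝓧 × 𝓨)) [IsProbabilityMeasure P]
    (μ : Measure Ω) [IsProbabilityMeasure μ]
    (X : Fin n → Ω → 𝓧) (Y : Fin n → Ω → 𝓨)
    (hX : ∀ i, Measurable (X i)) (hY : ∀ i, Measurable (Y i))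
    (h_indep : iIndepFun (fun i ω => (X i ω, Y i ω)) μ)
    (h_law : ∀ i, μ.map (fun ω => (X i ω, Y i ω)) = P)
    (hK : ∀ᵐ ω ∂μ, (VectorKernel.kernelMatrix k fun i => X i ω).rank = n * d)
    -- the loss
    (ℓ : EuclideanSpace ℝ (Fin d) → 𝓨 → ℝ)
    (hℓ_nonneg : ∀ u y, 0 ≤ ℓ u y) (hℓ_self : ∀ y : 𝓨, ℓ (y : EuclideanSpace ℝ (Fin d)) y = 0)
    (lam γ δ : ℝ) (hlam : 0 < lam) (hγ : 0 < γ) (hδ : 0 < δ)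
    (M₀ : ℕ) (hM₀ : M₀ = ⌈γ * √(n : ℝ) / (4 * d * √κ)⌉₊) :
    ∃ E : Set Ω, MeasurableSet E ∧ 1 - δ ≤ μ.real E ∧ ∀ ω ∈ E, ∀ f : H,
      IsMinOn (VectorKernel.regularizedRisk (H := H) ℓ lam (fun i => X i ω) fun i => Y i ω)
        Set.univ f →
      P.real {z | VectorKernel.margin (f z.1) (cls z.2) ≤ 0} ≤
        (1 / (n : ℝ)) *
            ∑ i, Set.indicator {z : 𝓧 × 𝓨 | VectorKernel.margin (f z.1) (cls z.2) ≤ γ}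
              (fun _ => (1 : ℝ)) (X i ω, Y i ω)
          + 4 * d * (VectorKernel.supervisionComplexity k (fun i => X i ω)
                (fun i => (Y i ω : EuclideanSpace ℝ (Fin d))) + 1) / (γ * n)
            * √((VectorKernel.kernelMatrix k fun i => X i ω).trace)
          + 3 * √(Real.log (2 * M₀ / δ) / (2 * n)) := by

  have hnR : (0 : ℝ) < n := Nat.cast_pos.2 hn
  have hdR : (0 : ℝ) < d := Nat.cast_pos.2 (by omega)
  set i₀ : Fin n := ⟨0, hn⟩
  set j₀ : Fin d := ⟨0, by omega⟩
  have hXY : ∀ i, Measurable fun ω => (X i ω, Y i ω) := fun i => (hX i).prodMk (hY i)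
  rcases le_or_gt 1 δ with hδ1 | hδ1
  · exact ⟨∅, .empty, by simpa using hδ1, by simp⟩
  -- the confidence term is smallest for `M₀ = 1`
  have hM₀1 : (1 : ℝ) ≤ M₀ := by
    obtain ⟨ω, hω⟩ := hK.exists
    -- With `κ = 0` the quotient defining `M₀` would be `0` by convention; a full rank sample rules
    -- this out.
    have hκ0 : 0 < κ := (VectorKernel.kernel_diag_pos (H := H) hH hω i₀ j₀).trans_le
      (hκ.1 ⟨(X i₀ ω, j₀), rfl⟩)
    rw [hM₀]
    exact_mod_cast Nat.one_le_iff_ne_zero.2 (Nat.ceil_pos.2 (by positivity)).ne'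
  have hlog : 3 * √(Real.log (2 / δ) / (2 * n)) ≤ 3 * √(Real.log (2 * M₀ / δ) / (2 * n)) := by
    gcongr
    linarith
  obtain ⟨N, hKN, hNm, hN⟩ := exists_measurable_superset_of_null (ae_iff.1 hK)
  have hfull : ∀ ω ∉ N, (VectorKernel.kernelMatrix k fun i => X i ω).rank = n * d := fun ω hω =>
    not_not.1 fun h => hω (hKN h)
  have hN0 : μ.real N = 0 := by rw [measureReal_def, hN, ENNReal.toReal_zero]
  rcases le_or_gt (√(Real.log (2 / δ) / (2 * n))) (1 / 3) with hy | hy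
  · have hpos : ∀ᵐ z ∂P, 0 < (k z.1 z.1).trace := by
      have hm : Measurable fun z : 𝓧 × 𝓨 => (k z.1 z.1).trace :=
        Finset.measurable_sum _ fun j _ => (hk_meas j j).comp (measurable_fst.prodMk measurable_fst)
      rw [← h_law i₀, ae_map_iff (hXY i₀).aemeasurable (measurableSet_lt measurable_const hm)]
      filter_upwards [hK] with ω hω
      exact VectorKernel.trace_pos (H := H) hH (by omega) hω i₀
    obtain ⟨B, hBm, hB, hbound⟩ := VectorKernel.exists_measurableSet_margin_bound (H := H) hH hk_meas
      hd hcls P hpos hn hγ hδ hδ1 hy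
    have hSm : Measurable fun ω i => (X i ω, Y i ω) := measurable_pi_lambda _ hXY
    have hmap : μ.map (fun ω i => (X i ω, Y i ω)) = Measure.pi fun _ => P := by
      rw [(iIndepFun_iff_map_fun_eq_pi_map fun i => (hXY i).aemeasurable).1 h_indep]
      simp only [h_law]
    have hSB : μ.real ((fun ω i => (X i ω, Y i ω)) ⁻¹' B) ≤ δ := by
      rwa [← map_measureReal_apply hSm hBm, hmap]
    refine ⟨(N ∪ (fun ω i => (X i ω, Y i ω)) ⁻¹' B)ᶜ, (hNm.union (hSm hBm)).compl, ?_,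
      fun ω hω f hf => ?_⟩
    · rw [probReal_compl_eq_one_sub (hNm.union (hSm hBm))]
      have := measureReal_union_le (μ := μ) N ((fun ω i => (X i ω, Y i ω)) ⁻¹' B)
      linarith
    · rw [Set.mem_compl_iff, Set.mem_union, not_or] at hω
      have hS := VectorKernel.norm_sq_le_supervisionComplexity hH (hfull ω hω.1)
        (fun i => Y i ω) hℓ_nonneg hℓ_self hlam hf
      refine (hbound _ hω.2 f).trans ?_
      rw [VectorKernel.trace_kernelMatrix]
      gcongr
  -- Here the confidence term alone exceeds one, so only nonnegativity of the other terms is needed.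
  · refine ⟨Nᶜ, hNm.compl, ?_, fun ω hω f _ => ?_⟩
    · rw [probReal_compl_eq_one_sub hNm, hN0]
      linarith
    · have hS := VectorKernel.supervisionComplexity_nonneg (H := H) hH (hfull ω hω)
        fun i => (Y i ω : EuclideanSpace ℝ (Fin d))
      have h1 : P.real {z | VectorKernel.margin (f z.1) (cls z.2) ≤ 0} ≤ 1 := measureReal_le_one
      have h2 : 0 ≤ (1 / (n : ℝ)) *
          ∑ i, Set.indicator {z : 𝓧 × 𝓨 | VectorKernel.margin (f z.1) (cls z.2) ≤ γ}
            (fun _ => (1 : ℝ)) (X i ω, Y i ω) :=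
        mul_nonneg (by positivity) (Finset.sum_nonneg fun i _ =>
          Set.indicator_nonneg (fun _ _ => zero_le_one) _)
      have h3 : 0 ≤ 4 * d * (VectorKernel.supervisionComplexity k (fun i => X i ω)
          (fun i => (Y i ω : EuclideanSpace ℝ (Fin d))) + 1) / (γ * n)
            * √((VectorKernel.kernelMatrix k fun i => X i ω).trace) := by positivity
      linarith
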